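/- For a manifold $X$ let $C_n(X)\subseteq X^n$ be the (open) configuration space of ordered $n$-tuples of distinct points of $X$. Let $B^4\subseteq\mathbb{RP}^4$ be a closed round 4-ball, i.e. the closed ball with some centre $c\in\mathbb R^4$ and radius $r>0$ in the affine chart $\mathbb R^4\subseteq\mathbb{RP}^4$, and identify $S^3$ with $\partial B^4$ via $x\mapsto c+rx$. For $p\in\mathbb{RP}^4\setminus B^4$ let $T_p\subseteq\partial B^4$ be the set of points at which some projective line through $p$ is tangent to $\partial B^4$ (meets $\partial B^4$ in exactly that point); two points of $\partial B^4$ are on the same side of $T_p$ if they lie in the same connected component of $\partial B^4\setminus T_p$. If $\ell_1,\ell_2,\ell_3$ are three distinct lines through $p$, each meeting $\partial B^4$ in exactly two points, let $G(\ell_1,\ell_2,\ell_3)$ be the graph whose vertices are the intersection points of the three lines with $\partial B^4$, two distinct vertices being joined if they are on the same side of $T_p$ or on the same line $\ell_i$; let $G^c$ be its complement graph, and let $\mathrm{Cyc}_6$ be the 6-cycle on $\{1,\dots,6\}$ with edges between numbers differing by $1$ mod $6$. Let $M$ be the moduli space of the following data: (1) a point $p\in\mathbb{RP}^4\setminus B^4$;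 (2) an unordered triple $\{\ell_1,\ell_2,\ell_3\}$ of distinct lines, each passing through $p$ and meeting $\partial B^4$ in exactly two points; (3) a graph isomorphism $G^c(\ell_1,\ell_2,\ell_3)\to\mathrm{Cyc}_6$. Sending such data to the 6-tuple $(x_1,\dots,x_6)$ of intersection points, ordered by the labels given by the isomorphism, defines a map $M\to C_6(S^3)$, and $M$ is given the topology induced by this map. Then $M$ has the structure of a 13-dimensional smooth manifold for which the map $M\to C_6(S^3)$ is a smooth embedding (a topological embedding that is smooth with injective differentials), and with this structure $M$ is diffeomorphic to $\mathbb{R}\times S^3\times C_3(\mathbb{R}^3)$. -/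

import Mathlib

open scoped Manifold ContDiff LinearAlgebra.Projectivization

/-- The configuration space `C_n(X)` of ordered `n`-tuples of distinct points of `X`,
an open subset of `X^n` (and hence, when `X` is a manifold, an open submanifold of the
product manifold `X^n`). -/
def Conf (n : ℕ) (X : Type*) [TopologicalSpace X] [T2Space X] :
    TopologicalSpace.Opens (Fin n → X) where
  carrier := {x | Function.Injective x}
  is_open' := by
    have h : {x : Fin n → X | Function.Injective x} =
        ⋂ (i : Fin n) (j : Fin n) (_ : i ≠ j), {x | x i ≠ x j} := by
      ext x
      simp only [Set.mem_ofPred_eq, Set.mem_iInter, Function.Injective]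
      exact ⟨fun h i j hij e => hij (h e), fun h i j e => by
        by_contra hij
        exact h i j hij e⟩
    rw [h]
    refine isOpen_iInter_of_finite fun i => isOpen_iInter_of_finite fun j =>
      isOpen_iInter_of_finite fun _ => ?_
    exact isOpen_ne_fun (continuous_apply i) (continuous_apply j)

/-- Euclidean `k`-space. -/
abbrev Euc (k : ℕ) : Type := EuclideanSpace ℝ (Fin k)

/-- The unit sphere `S³ ⊆ ℝ⁴`. -/
abbrev S3 : Type := Metric.sphere (0 : Euc 4) 1

/-- Real projective 4-space, with homogeneous coordinates `[y : s]`, `y ∈ ℝ⁴`, `s ∈ ℝ`. -/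
abbrev RP4 : Type := ℙ ℝ (Euc 4 × ℝ)

/-- The affine chart `ℝ⁴ → ℝP⁴`, `y ↦ [y : 1]`. -/
noncomputable def affinePt (y : Euc 4) : RP4 :=
  Projectivization.mk ℝ (y, (1 : ℝ)) (fun h => one_ne_zero (congrArg Prod.snd h))

/-- A projective line in `ℝP⁴`: the points lying in a 2-dimensional linear subspace. -/
def IsLine (ℓ : Set RP4) : Prop :=
  ∃ W : Submodule ℝ (Euc 4 × ℝ), Module.finrank ℝ W = 2 ∧ ℓ = {q | q.submodule ≤ W}

/-- The closed round 4-ball `B⁴ ⊆ ℝP⁴` with centre `c` and radius `r` in the affine chart. -/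
def ball4 (c : Euc 4) (r : ℝ) : Set RP4 := affinePt '' Metric.closedBall c r

/-- The identification of `S³` with the boundary sphere `∂B⁴`. -/
noncomputable def bdry (c : Euc 4) (r : ℝ) (x : S3) : RP4 := affinePt (c + r • (x : Euc 4))

/-- The set `T_p` of points of `∂B⁴` (seen as points of `S³`) at which some line through `p` is
tangent to `∂B⁴`, i.e. meets `∂B⁴` at exactly that point. -/
def tangencySet (c : Euc 4) (r : ℝ) (p : RP4) : Set S3 :=
  {x | ∃ ℓ : Set RP4, IsLine ℓ ∧ p ∈ ℓ ∧ ℓ ∩ Set.range (bdry c r) = {bdry c r x}}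

/-- `a` and `b` lie on the same side of `T_p`: they lie in the same connected component
of the complement of `T_p` in the sphere. (This is false if `a` or `b` lies on `T_p`.) -/
def SameSide (c : Euc 4) (r : ℝ) (p : RP4) (a b : S3) : Prop :=
  b ∈ connectedComponentIn (tangencySet c r p)ᶜ a

/-- The points at which the sphere `∂B⁴` meets the lines of the family `L`. -/
abbrev IntersectionPt (c : Euc 4) (r : ℝ) (L : Set (Set RP4)) : Type :=
  {x : S3 // ∃ ℓ ∈ L, bdry c r x ∈ ℓ}

/-- The graph `G` on the intersection points of `∂B⁴` with the lines of `L`: two points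
are joined if they are on the same side of `T_p` or on the same line of `L`. -/
def lineGraph (c : Euc 4) (r : ℝ) (p : RP4) (L : Set (Set RP4)) :
    SimpleGraph (IntersectionPt c r L) :=
  SimpleGraph.fromRel fun a b =>
    SameSide c r p a.1 b.1 ∨ ∃ ℓ ∈ L, bdry c r a.1 ∈ ℓ ∧ bdry c r b.1 ∈ ℓ

/-- The data parametrised by the moduli space `M`. -/
structure Moduli (c : Euc 4) (r : ℝ) where
  /-- the point of concurrence -/
  p : RP4
  p_notMem : p ∉ ball4 c r
  /-- the unordered triple of distinct lines -/
  lines : Set (Set RP4)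
  ncard_lines : lines.ncard = 3
  isLine : ∀ ℓ ∈ lines, IsLine ℓ
  p_mem : ∀ ℓ ∈ lines, p ∈ ℓ
  meets_twice : ∀ ℓ ∈ lines, (ℓ ∩ Set.range (bdry c r)).ncard = 2
  /-- the identification of the complement graph with the 6-cycle -/
  iso : (lineGraph c r p lines)ᶜ ≃g SimpleGraph.cycleGraph 6

/-- The 6-tuple of intersection points, ordered by the labelling coming from the isomorphism
with the 6-cycle. -/
def Moduli.label {c : Euc 4} {r : ℝ} (m : Moduli c r) : Conf 6 S3 :=
  ⟨fun i => (m.iso.symm i).1, Subtype.val_injective.comp m.iso.symm.injective⟩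

/-- `M` carries the topology of a subset of `C₆(S³)`. -/
instance (c : Euc 4) (r : ℝ) : TopologicalSpace (Moduli c r) :=
  TopologicalSpace.induced Moduli.label inferInstance

/-- The model for the product manifold `(S³)⁶` and its open subset `C₆(S³)`. -/
noncomputable abbrev modelConf6 := ModelWithCorners.pi (fun _ : Fin 6 => 𝓡 3)

/-- The model for the product manifold `(ℝ³)³` and its open subset `C₃(ℝ³)`. -/
noncomputable abbrev modelConf3 := ModelWithCorners.pi (fun _ : Fin 3 => 𝓡 3)

/-! After an affine change of coordinates the ball is the unit ball, and its boundary is the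
projectivised light cone of the form `lor` of signature (4,1). A point outside the ball is a pair ±v
with `lor v v = 1`, i.e. a point of de Sitter space up to sign. The tangency set T_p is the zero set
of `lor v` on the sphere, and its two sides are the two signs of `lor v`. The Lorentz reflection in
v induces an involution of the sphere that exchanges the sides. The lines through p that meet the
sphere correspond to the orbits of this involution, and the tangent lines to its fixed points.

Hence G consists of two triangles, one on each side, joined by a perfect matching, and its
complement is a 6-cycle. Along the cycle the sides alternate, and opposite vertices lie on the same
line. Requiring `lor v` to be positive at the vertex 0 removes the ambiguity of sign, so the data
amount to v together with three distinct ordered points (the even vertices) of the cap where `lor v`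
is positive; the odd vertices are their reflections. De Sitter space is ℝ × S³ through v =
(√(1+t²)u, t). The caps are identified with ℝ³ smoothly in (t, u), because quaternion multiplication
trivialises the tangent bundle of S³. This gives ℝ × S³ × C₃(ℝ³).

For the embedding, v is recovered from the six points by an explicit formula (`rawVec_hexagon`),
smooth near the image. So the parametrisation has a smooth left inverse `recover`, which makes it an
immersion and a homeomorphism onto its image. The smooth structure on M is transported from the
parameters. The geometric input is `bdry_mem_lineThru`, `IsPoint.tangencySet_eq`,
`IsPoint.sameSide_iff` and `Moduli.exists_label_eq_paramConf`. -/

/-! ### Finite products of manifolds -/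

section PiManifold

variable {𝕜 : Type*} [NontriviallyNormedField 𝕜] {ι : Type*} [Fintype ι]
  {E : ι → Type*} [∀ i, NormedAddCommGroup (E i)] [∀ i, NormedSpace 𝕜 (E i)]
  {H : ι → Type*} [∀ i, TopologicalSpace (H i)] {I : ∀ i, ModelWithCorners 𝕜 (E i) (H i)}
  {M : ι → Type*} [∀ i, TopologicalSpace (M i)] [∀ i, ChartedSpace (H i) (M i)] {n : ℕ∞ω}
  {F : Type*} [NormedAddCommGroup F] [NormedSpace 𝕜 F]
  {G : Type*} [TopologicalSpace G] {J : ModelWithCorners 𝕜 F G}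
  {N : Type*} [TopologicalSpace N] [ChartedSpace G N]

theorem contMDiffAt_pi_of_forall {f : N → ∀ i, M i} {x : N}
    (h : ∀ i, ContMDiffAt J (I i) n (fun y => f y i) x) :
    ContMDiffAt J (ModelWithCorners.pi I) n f x := by
  rw [contMDiffAt_iff_target]
  refine ⟨continuousAt_pi.2 fun i => (h i).continuousAt, ?_⟩
  rw [contMDiffAt_pi_space]
  exact fun i => (contMDiffAt_iff_target.1 (h i)).2

theorem contMDiff_pi_of_forall {f : N → ∀ i, M i}
    (h : ∀ i, ContMDiff J (I i) n (fun y => f y i)) :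
    ContMDiff J (ModelWithCorners.pi I) n f :=
  fun x => contMDiffAt_pi_of_forall fun i => h i x

theorem ModelWithCorners.range_pi_subset (i : ι) :
    Set.MapsTo (fun y : ∀ i, E i => y i) (Set.range (ModelWithCorners.pi I)) (Set.range (I i)) := by
  rintro _ ⟨y, rfl⟩
  exact ⟨y i, rfl⟩

/-- In product charts the evaluation map is the linear projection to one factor. -/
theorem contMDiff_pi_apply (i : ι) :
    ContMDiff (ModelWithCorners.pi I) (I i) n (fun f : ∀ i, M i => f i) := by
  intro f
  rw [contMDiffAt_iff]
  refine ⟨(continuous_apply i).continuousAt, ?_⟩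
  have h : ContDiffWithinAt 𝕜 n (fun y : ∀ i, E i => y i) (Set.range (ModelWithCorners.pi I))
      (extChartAt (ModelWithCorners.pi I) f f) := (ContinuousLinearMap.proj (R := 𝕜) (φ := E) i).contDiff.contDiffWithinAt
  refine h.congr_of_eventuallyEq_of_mem ?_ ⟨_, rfl⟩
  filter_upwards [extChartAt_target_mem_nhdsWithin (I := ModelWithCorners.pi I) f] with y hy
  have hi : y i ∈ (extChartAt (I i) (f i)).target := by
    rw [extChartAt_target] at hy ⊢
    exact ⟨hy.1 i trivial, ModelWithCorners.range_pi_subset i hy.2⟩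
  exact (extChartAt (I i) (f i)).right_inv hi

instance ModelWithCorners.boundaryless_pi [∀ i, (I i).Boundaryless] :
    (ModelWithCorners.pi I).Boundaryless := by
  constructor
  refine Set.eq_univ_of_forall fun y => ?_
  have : ∀ i, ∃ x, I i x = y i := fun i => by
    have := (I i).range_eq_univ ▸ Set.mem_univ (y i)
    exact this
  choose x hx using this
  exact ⟨x, funext hx⟩

instance IsManifold.pi [∀ i, IsManifold (I i) n (M i)] :
    IsManifold (ModelWithCorners.pi I) n (∀ i, M i) := by
  apply isManifold_of_contDiffOn
  rintro _ _ ⟨e, he, rfl⟩ ⟨e', he', rfl⟩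
  rw [contDiffOn_pi]
  intro i
  have h := ((contDiffGroupoid n (I i)).compatible (he i trivial) (he' i trivial)).1
  refine ContDiffOn.comp (g := (I i) ∘ ((e i).symm ≫ₕ e' i) ∘ (I i).symm)
    h (ContinuousLinearMap.proj (R := 𝕜) (φ := E) i).contDiff.contDiffOn ?_
  rintro y ⟨hy, hy'⟩
  exact ⟨⟨hy.1 i trivial, hy.2 i trivial⟩, ModelWithCorners.range_pi_subset i hy'⟩

end PiManifold

/-! ### Transport of a smooth structure along a homeomorphism -/

section Transport

variable {𝕜 : Type*} [NontriviallyNormedField 𝕜]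
  {E : Type*} [NormedAddCommGroup E] [NormedSpace 𝕜 E]
  {E' : Type*} [NormedAddCommGroup E'] [NormedSpace 𝕜 E']
  {H : Type*} [TopologicalSpace H] {I : ModelWithCorners 𝕜 E H} [I.Boundaryless]
  {M N : Type*} [TopologicalSpace M] [TopologicalSpace N] [ChartedSpace H N]

/-- A chart of `N`, pulled back along a homeomorphism `M ≃ₜ N` and read in a vector space
isomorphic to the model vector space. -/
def transportChart (φ : M ≃ₜ N) (κ : H ≃ₜ E') (e : OpenPartialHomeomorph N H) :
    OpenPartialHomeomorph M E' :=
  (φ.transOpenPartialHomeomorph e).transHomeomorph κ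

/-- The charted space structure on `M` transported from `N` along a homeomorphism. -/
@[reducible] def transportChartedSpace (φ : M ≃ₜ N) (κ : H ≃ₜ E') : ChartedSpace E' M where
  atlas := transportChart φ κ '' atlas H N
  chartAt x := transportChart φ κ (chartAt H (φ x))
  mem_chart_source x := mem_chart_source H (φ x)
  chart_mem_atlas x := ⟨_, chart_mem_atlas H (φ x), rfl⟩

variable {n : ℕ∞ω}

/-- The homeomorphism cancels in every transition map, which is therefore a transition map of `N`
conjugated by `L`. The change of model space is what allows the single vector space `Euc 13` to
replace a product model. -/
theorem isManifold_transport [IsManifold I n N] (φ : M ≃ₜ N) (L : E ≃L[𝕜] E') :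
    let _ := transportChartedSpace φ (I.toHomeomorph.trans L.toHomeomorph)
    IsManifold 𝓘(𝕜, E') n M := by
  let _ := transportChartedSpace φ (I.toHomeomorph.trans L.toHomeomorph)
  apply isManifold_of_contDiffOn
  rintro _ _ ⟨e, he, rfl⟩ ⟨e', he', rfl⟩
  have h := ((contDiffGroupoid n I).compatible he he').1
  have h2 := (L.contDiff.comp_contDiffOn h).comp
    (s := L.symm ⁻¹' (I.symm ⁻¹' (e.symm ≫ₕ e').source ∩ Set.range I))
    L.symm.contDiff.contDiffOn (fun x hx => hx)
  refine (h2.congr ?_).mono ?_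
  · rintro y -
    simp [transportChart]
  · rintro y ⟨hy, -⟩
    refine ⟨⟨hy.1, ?_⟩, I.range_eq_univ ▸ Set.mem_univ _⟩
    simpa [transportChart] using hy.2

/-- In corresponding charts `φ` reads as `L.symm` and its inverse as `L`. -/
theorem contMDiff_transport (φ : M ≃ₜ N) (L : E ≃L[𝕜] E') :
    let _ := transportChartedSpace φ (I.toHomeomorph.trans L.toHomeomorph)
    ContMDiff 𝓘(𝕜, E') I n φ ∧ ContMDiff I 𝓘(𝕜, E') n φ.symm := by
  let _ := transportChartedSpace φ (I.toHomeomorph.trans L.toHomeomorph)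
  constructor
  · intro x
    rw [contMDiffAt_iff]
    refine ⟨φ.continuous.continuousAt, ?_⟩
    refine L.symm.contDiff.contDiffWithinAt.congr_of_eventuallyEq_of_mem ?_ ⟨_, rfl⟩
    filter_upwards [extChartAt_target_mem_nhdsWithin (I := 𝓘(𝕜, E')) x] with y hy
    have hy' : L.symm y ∈ (extChartAt I (φ x)).target := by
      rw [extChartAt_target] at hy ⊢
      exact ⟨hy.1, I.range_eq_univ ▸ Set.mem_univ _⟩
    refine Eq.trans ?_ ((extChartAt I (φ x)).right_inv hy')
    exact congrArg (extChartAt I (φ x)) (φ.apply_symm_apply _)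
  · intro x
    rw [contMDiffAt_iff]
    refine ⟨φ.symm.continuous.continuousAt, ?_⟩
    refine L.contDiff.contDiffWithinAt.congr_of_eventuallyEq_of_mem ?_ ⟨_, rfl⟩
    filter_upwards [extChartAt_target_mem_nhdsWithin (I := I) x] with y hy
    refine Eq.trans ?_ (congrArg L ((extChartAt I x).right_inv hy))
    change L (I (chartAt H (φ (φ.symm x)) (φ (φ.symm _)))) = _
    rw [φ.apply_symm_apply, φ.apply_symm_apply]
    rfl

end Transport

/-! ### Quaternionic trivialisation of the tangent bundle of S³ -/

/-- Right multiplication of the quaternion `u` by the imaginary quaternion `w`; for a unit vector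
`u` this is an isometry of `ℝ³` onto the orthogonal complement of `u`. -/
noncomputable def frame (u : Euc 4) (w : Euc 3) : Euc 4 :=
  !₂[-(u 1 * w 0) - u 2 * w 1 - u 3 * w 2, u 0 * w 0 - u 3 * w 1 + u 2 * w 2,
    u 3 * w 0 + u 0 * w 1 - u 1 * w 2, -(u 2 * w 0) + u 1 * w 1 + u 0 * w 2]

/-- The adjoint of `frame u`. -/
noncomputable def coframe (u : Euc 4) (x : Euc 4) : Euc 3 :=
  !₂[-(u 1 * x 0) + u 0 * x 1 + u 3 * x 2 - u 2 * x 3,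
    -(u 2 * x 0) - u 3 * x 1 + u 0 * x 2 + u 1 * x 3,
    -(u 3 * x 0) + u 2 * x 1 - u 1 * x 2 + u 0 * x 3]

theorem inner_euc4 (x y : Euc 4) :
    inner ℝ x y = x 0 * y 0 + x 1 * y 1 + x 2 * y 2 + x 3 * y 3 := by
  simp [PiLp.inner_apply, Fin.sum_univ_four, mul_comm]

theorem inner_euc3 (x y : Euc 3) :
    inner ℝ x y = x 0 * y 0 + x 1 * y 1 + x 2 * y 2 := by
  simp [PiLp.inner_apply, Fin.sum_univ_three, mul_comm]

theorem inner_frame_frame (u : Euc 4) (w w' : Euc 3) :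
    inner ℝ (frame u w) (frame u w') = inner ℝ u u * inner ℝ w w' := by
  simp only [inner_euc4, inner_euc3, frame, Matrix.cons_val]
  ring

theorem inner_self_frame (u : Euc 4) (w : Euc 3) : inner ℝ u (frame u w) = 0 := by
  simp only [inner_euc4, frame, Matrix.cons_val]
  ring

theorem coframe_frame (u : Euc 4) (w : Euc 3) :
    coframe u (frame u w) = (inner ℝ u u : ℝ) • w := by
  rw [inner_euc4]
  ext i
  fin_cases i <;> simp [frame, coframe] <;> ring

theorem coframe_self (u : Euc 4) : coframe u u = 0 := by
  ext i
  fin_cases i <;> simp [coframe] <;> ring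

theorem coframe_add (u x y : Euc 4) : coframe u (x + y) = coframe u x + coframe u y := by
  ext i
  fin_cases i <;> simp [coframe] <;> ring

theorem coframe_smul (u : Euc 4) (s : ℝ) (x : Euc 4) : coframe u (s • x) = s • coframe u x := by
  ext i
  fin_cases i <;> simp [coframe] <;> ring

theorem frame_smul (u : Euc 4) (s : ℝ) (w : Euc 3) : frame u (s • w) = s • frame u w := by
  ext i
  fin_cases i <;> simp [frame] <;> ring

theorem inner_smul_add_frame_coframe (u x : Euc 4) :
    (inner ℝ u x : ℝ) • u + frame u (coframe u x) = (inner ℝ u u : ℝ) • x := by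
  rw [inner_euc4, inner_euc4]
  ext i
  fin_cases i <;> simp [frame, coframe] <;> ring

/-! ### The Lorentz form, the light cone and reflections -/

/-- The Lorentz form on `ℝ⁴ × ℝ`. -/
noncomputable def lor (v v' : Euc 4 × ℝ) : ℝ := inner ℝ v.1 v'.1 - v.2 * v'.2

theorem lor_comm (v v' : Euc 4 × ℝ) : lor v v' = lor v' v := by
  simp [lor, real_inner_comm, mul_comm]

theorem lor_add_left (a b v : Euc 4 × ℝ) : lor (a + b) v = lor a v + lor b v := by
  simp [lor, inner_add_left]; ring

theorem lor_sub_left (a b v : Euc 4 × ℝ) : lor (a - b) v = lor a v - lor b v := by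
  simp [lor, inner_sub_left]; ring

theorem lor_smul_left (s : ℝ) (a v : Euc 4 × ℝ) : lor (s • a) v = s * lor a v := by
  simp [lor, real_inner_smul_left]; ring

theorem lor_add_right (a b v : Euc 4 × ℝ) : lor v (a + b) = lor v a + lor v b := by
  simp only [lor_comm v, lor_add_left]

theorem lor_sub_right (a b v : Euc 4 × ℝ) : lor v (a - b) = lor v a - lor v b := by
  simp only [lor_comm v, lor_sub_left]

theorem lor_smul_right (s : ℝ) (a v : Euc 4 × ℝ) : lor v (s • a) = s * lor v a := by
  simp only [lor_comm v, lor_smul_left]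

/-- The representative in the light cone of a point of the sphere. -/
def cone (x : Euc 4) : Euc 4 × ℝ := (x, 1)

theorem lor_cone_cone (x y : Euc 4) : lor (cone x) (cone y) = inner ℝ x y - 1 := by
  simp [lor, cone]

theorem lor_cone_self {x : Euc 4} (hx : ‖x‖ = 1) : lor (cone x) (cone x) = 0 := by
  simp [lor_cone_cone, hx]

theorem lor_cone_neg {x y : Euc 4} (hx : ‖x‖ = 1) (hy : ‖y‖ = 1) (h : x ≠ y) :
    lor (cone x) (cone y) < 0 := by
  rw [lor_cone_cone, sub_neg]
  exact (inner_lt_one_iff_real_of_norm_eq_one hx hy).2 h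

/-- The point in which the line through `[v]` and the point `x` of the sphere meets the sphere
again, for a vector `v` with `lor v v = 1`. -/
noncomputable def reflPt (v : Euc 4 × ℝ) (x : Euc 4) : Euc 4 :=
  (1 - 2 * lor v (cone x) * v.2)⁻¹ • (x - (2 * lor v (cone x)) • v.1)

/-- The quantity is the last coordinate of the reflected vector: reflection in a spacelike vector
preserves the future light cone. -/
theorem reflPt_denom_pos {v : Euc 4 × ℝ} (hv : lor v v = 1) {x : Euc 4} (hx : ‖x‖ = 1) :
    0 < 1 - 2 * lor v (cone x) * v.2 := by
  have h1 : inner ℝ v.1 v.1 = 1 + v.2 ^ 2 := by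
    simp only [lor] at hv
    linarith
  have h2 := real_inner_mul_inner_self_le v.1 x
  rw [h1, real_inner_self_eq_norm_sq, hx] at h2
  simp only [lor, cone]
  set s := inner ℝ v.1 x
  set t := v.2
  -- Cauchy–Schwarz gives s² ≤ 1 + t², and 4t²(1 + t²) falls short of (1 + 2t²)² by exactly 1.
  have : (2 * t * s) ^ 2 < (1 + 2 * t ^ 2) ^ 2 := by nlinarith [sq_nonneg t]
  have := abs_lt_of_sq_lt_sq this (by positivity)
  have := (abs_lt.1 this).2
  nlinarith

theorem cone_reflPt {v : Euc 4 × ℝ} (hv : lor v v = 1) {x : Euc 4} (hx : ‖x‖ = 1) :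
    cone (reflPt v x) =
      (1 - 2 * lor v (cone x) * v.2)⁻¹ • (cone x - (2 * lor v (cone x)) • v) := by
  have h := (reflPt_denom_pos hv hx).ne'
  ext1
  · rfl
  · simp only [cone, reflPt, Prod.smul_snd, Prod.snd_sub, smul_eq_mul]
    exact (inv_mul_cancel₀ h).symm

theorem norm_reflPt {v : Euc 4 × ℝ} (hv : lor v v = 1) {x : Euc 4} (hx : ‖x‖ = 1) :
    ‖reflPt v x‖ = 1 := by
  have h : lor (cone (reflPt v x)) (cone (reflPt v x)) = 0 := by
    rw [cone_reflPt hv hx]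
    simp only [lor_smul_left, lor_smul_right, lor_sub_left, lor_sub_right, lor_cone_self hx, hv,
      lor_comm (cone x) v]
    ring
  rw [lor_cone_cone, real_inner_self_eq_norm_sq] at h
  nlinarith [norm_nonneg (reflPt v x)]

theorem lor_reflPt {v : Euc 4 × ℝ} (hv : lor v v = 1) {x : Euc 4} (hx : ‖x‖ = 1) :
    lor v (cone (reflPt v x)) = -((1 - 2 * lor v (cone x) * v.2)⁻¹ * lor v (cone x)) := by
  rw [cone_reflPt hv hx]
  simp only [lor_smul_right, lor_sub_right, hv]
  ring

/-! ### Coordinates on de Sitter space and on the caps -/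

/-- `√(1 + t²)`. -/
noncomputable def hyp (t : ℝ) : ℝ := √(1 + t ^ 2)

theorem hyp_pos (t : ℝ) : 0 < hyp t := Real.sqrt_pos.2 (by positivity)

theorem hyp_sq (t : ℝ) : hyp t ^ 2 = 1 + t ^ 2 := Real.sq_sqrt (by positivity)

/-- The vector of de Sitter space with parameters `t` and `u`. -/
noncomputable def dsPt (t : ℝ) (u : Euc 4) : Euc 4 × ℝ := (hyp t • u, t)

theorem lor_dsPt (t : ℝ) {u : Euc 4} (hu : ‖u‖ = 1) : lor (dsPt t u) (dsPt t u) = 1 := by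
  simp only [lor, dsPt, real_inner_smul_left, real_inner_smul_right, real_inner_self_eq_norm_sq u,
    hu]
  linarith [hyp_sq t]

/-- The value of the linear form `lor (dsPt t u)` at the point `capPt t u w`. -/
noncomputable def capHeight (t : ℝ) (w : Euc 3) : ℝ :=
  (t + √(t ^ 2 + (1 + (1 + t ^ 2) * ‖w‖ ^ 2)))⁻¹

theorem capHeight_denom_pos (t : ℝ) (w : Euc 3) :
    0 < t + √(t ^ 2 + (1 + (1 + t ^ 2) * ‖w‖ ^ 2)) := by
  have : |t| < √(t ^ 2 + (1 + (1 + t ^ 2) * ‖w‖ ^ 2)) := by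
    rw [← Real.sqrt_sq_eq_abs]
    exact Real.sqrt_lt_sqrt (by positivity) (lt_add_of_pos_right _ (by positivity))
  linarith [neg_abs_le t]

theorem capHeight_pos (t : ℝ) (w : Euc 3) : 0 < capHeight t w :=
  inv_pos.2 (capHeight_denom_pos t w)

/-- This quadratic equation is the condition that `capPt t u w` have norm 1. `capHeight` is its
positive root, with the numerator rationalised so that no division by the leading coefficient
occurs. -/
theorem capHeight_eq (t : ℝ) (w : Euc 3) :
    capHeight t w ^ 2 * (1 + (1 + t ^ 2) * ‖w‖ ^ 2) + 2 * t * capHeight t w = 1 := by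
  have h := capHeight_denom_pos t w
  have hs : √(t ^ 2 + (1 + (1 + t ^ 2) * ‖w‖ ^ 2)) ^ 2 = _ := Real.sq_sqrt (by positivity)
  rw [capHeight]
  set s := √(t ^ 2 + (1 + (1 + t ^ 2) * ‖w‖ ^ 2))
  field_simp
  nlinarith

/-- The product of the two roots is negative, so only one is positive. -/
theorem capHeight_unique {t : ℝ} {w : Euc 3} {b : ℝ} (hb : 0 < b)
    (h : b ^ 2 * (1 + (1 + t ^ 2) * ‖w‖ ^ 2) + 2 * t * b = 1) : b = capHeight t w := by
  have h1 := capHeight_eq t w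
  have h2 := capHeight_pos t w
  set c := capHeight t w
  set D := 1 + (1 + t ^ 2) * ‖w‖ ^ 2
  have hD : 0 < D := by positivity
  have h3 : (b - c) * (b * c * D + 1) = 0 := by linear_combination c * h - b * h1
  rcases mul_eq_zero.1 h3 with h4 | h4
  · linarith
  · have : 0 < b * c * D := by positivity
    linarith

/-- The diffeomorphism of `ℝ³` onto the open cap in which `lor (dsPt t u)` is positive. -/
noncomputable def capPt (t : ℝ) (u : Euc 4) (w : Euc 3) : Euc 4 :=
  ((capHeight t w + t) / hyp t) • u + capHeight t w • frame u w

theorem norm_capPt (t : ℝ) {u : Euc 4} (hu : ‖u‖ = 1) (w : Euc 3) : ‖capPt t u w‖ = 1 := by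
  have h : inner ℝ (capPt t u w) (capPt t u w) = 1 := by
    simp only [capPt, inner_add_left, inner_add_right, real_inner_smul_left, real_inner_smul_right,
      inner_frame_frame, inner_self_frame, real_inner_comm u, real_inner_self_eq_norm_sq u, hu,
      real_inner_self_eq_norm_sq w]
    have h1 := capHeight_eq t w
    have h2 := hyp_sq t
    have h3 := (hyp_pos t).ne'
    field_simp
    linear_combination h1 + (capHeight t w ^ 2 * ‖w‖ ^ 2 - 1) * h2
  rw [real_inner_self_eq_norm_sq] at h
  nlinarith [norm_nonneg (capPt t u w)]

theorem lor_capPt (t : ℝ) {u : Euc 4} (hu : ‖u‖ = 1) (w : Euc 3) :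
    lor (dsPt t u) (cone (capPt t u w)) = capHeight t w := by
  simp only [lor, dsPt, cone, capPt, inner_add_right, real_inner_smul_left, real_inner_smul_right,
      inner_self_frame, real_inner_self_eq_norm_sq u, hu]
  have h3 := (hyp_pos t).ne'
  field_simp
  ring

theorem coframe_capPt (t : ℝ) {u : Euc 4} (hu : ‖u‖ = 1) (w : Euc 3) :
    coframe u (capPt t u w) = capHeight t w • w := by
  simp [capPt, coframe_add, coframe_smul, coframe_self, coframe_frame, hu]

/-- The inverse chart projects x orthogonally to the complement of u and divides by the height of x
above the boundary of the cap. The height is recognised as `capHeight` because it is a positive root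
of the same quadratic. -/
theorem capPt_coframe {t : ℝ} {u : Euc 4} (hu : ‖u‖ = 1) {x : Euc 4} (hx : ‖x‖ = 1)
    (hb : 0 < lor (dsPt t u) (cone x)) :
    capPt t u ((lor (dsPt t u) (cone x))⁻¹ • coframe u x) = x := by
  have h1 := inner_smul_add_frame_coframe u x
  rw [real_inner_self_eq_norm_sq u, hu, one_pow, one_smul] at h1
  have h2 : inner ℝ u x ^ 2 + ‖coframe u x‖ ^ 2 = 1 := by
    have := real_inner_self_eq_norm_sq x
    rw [hx] at this
    rw [← h1] at this
    simp only [inner_add_left, inner_add_right, real_inner_smul_left, real_inner_smul_right,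
      inner_frame_frame, inner_self_frame, real_inner_comm u, real_inner_self_eq_norm_sq u, hu,
      real_inner_self_eq_norm_sq (coframe u x)] at this
    linarith
  have h3 : lor (dsPt t u) (cone x) = hyp t * inner ℝ u x - t := by
    simp [lor, dsPt, cone, real_inner_smul_left]
  set b := lor (dsPt t u) (cone x)
  have h4 := hyp_sq t
  have h5 := hyp_pos t
  have h6 : b = capHeight t (b⁻¹ • coframe u x) := by
    apply capHeight_unique hb
    rw [norm_smul, mul_pow, norm_inv, Real.norm_of_nonneg hb.le]
    field_simp
    rw [← h4]
    have h7 : b + t = hyp t * inner ℝ u x := by linarith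
    linear_combination (b + t + hyp t * inner ℝ u x) * h7 + hyp t ^ 2 * h2 + h4
  rw [capPt, ← h6, frame_smul, smul_inv_smul₀ hb.ne']
  have : (b + t) / hyp t = inner ℝ u x := by
    rw [h3]
    field_simp
    ring
  rw [this, h1]

/-! ### The hexagon and the recovery of its parameters -/

/-- The six intersection points determined by a vector `v` of de Sitter space and three points
on the positive side of its polar hyperplane, in cyclic order. -/
noncomputable def hexagon (v : Euc 4 × ℝ) (z : Fin 3 → Euc 4) : Fin 6 → Euc 4 :=
  ![z 0, reflPt v (z 2), z 1, reflPt v (z 0), z 2, reflPt v (z 1)]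

/-- The ambient vector space of the parameter manifold `ℝ × S³ × C₃(ℝ³)`. -/
abbrev ParamSpace : Type := ℝ × Euc 4 × (Fin 3 → Euc 3)

/-- The parametrisation of the moduli space. -/
noncomputable def paramMap (q : ParamSpace) : Fin 6 → Euc 4 :=
  hexagon (dsPt q.1 q.2.1) fun i => capPt q.1 q.2.1 (q.2.2 i)

/-- The coefficient of `cone (x 0)` in `rawVec x`. -/
noncomputable def rawCoeff (x : Fin 6 → Euc 4) : ℝ :=
  lor (cone (x 0)) (cone (x 2)) * lor (cone (x 3)) (cone (x 5)) +
    lor (cone (x 0)) (cone (x 5)) * lor (cone (x 2)) (cone (x 3)) -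
    lor (cone (x 0)) (cone (x 3)) * lor (cone (x 2)) (cone (x 5))

/-- A vector spanning the intersection of the line through `x 0`, `x 3` with the line through
`x 2`, `x 5`, if these lines are concurrent. -/
noncomputable def rawVec (x : Fin 6 → Euc 4) : Euc 4 × ℝ :=
  rawCoeff x • cone (x 0) -
    (2 * lor (cone (x 0)) (cone (x 2)) * lor (cone (x 0)) (cone (x 5))) • cone (x 3)

/-- The normalisation of `rawVec`. -/
noncomputable def recoverVec (x : Fin 6 → Euc 4) : Euc 4 × ℝ :=
  (√(lor (rawVec x) (rawVec x)))⁻¹ • rawVec x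

/-- A left inverse of `paramMap`. -/
noncomputable def recover (x : Fin 6 → Euc 4) : ParamSpace :=
  ((recoverVec x).2, (hyp (recoverVec x).2)⁻¹ • (recoverVec x).1, fun i =>
    (lor (recoverVec x) (cone (x (![0, 2, 4] i))))⁻¹ •
      coframe ((hyp (recoverVec x).2)⁻¹ • (recoverVec x).1) (x (![0, 2, 4] i)))

section Recover

variable {v : Euc 4 × ℝ} (hv : lor v v = 1) {z : Fin 3 → Euc 4} (hz : ∀ i, ‖z i‖ = 1)
  (hp : ∀ i, 0 < lor v (cone (z i))) (hne : z 0 ≠ z 1)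

include hv hz in
-- Write Xᵢ for the cone vectors and κ for the denominator of `reflPt v (z 0)`. Then X₀ − κX₃ is
-- twice `lor v (cone (z 0))` times v, and everything hinges on expressing κ through the six points
-- alone. The identity κ · `rawCoeff` = 2⟨X₀,X₂⟩⟨X₀,X₅⟩ does this without square roots, so `rawVec`
-- is `rawCoeff` times X₀ − κX₃ and is polynomial in the points.
theorem rawVec_hexagon :
    rawVec (hexagon v z) = (2 * rawCoeff (hexagon v z) * lor v (cone (z 0))) • v ∧
    rawCoeff (hexagon v z) = 2 * lor (cone (z 0)) (cone (z 1)) *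
      (lor (cone (z 0)) (cone (z 1)) - 2 * lor v (cone (z 0)) * lor v (cone (z 1))) *
      (1 - 2 * lor v (cone (z 0)) * v.2)⁻¹ * (1 - 2 * lor v (cone (z 1)) * v.2)⁻¹ := by
  have h0 := reflPt_denom_pos hv (hz 0)
  have h1 := reflPt_denom_pos hv (hz 1)
  have hA : rawCoeff (hexagon v z) = 2 * lor (cone (z 0)) (cone (z 1)) *
      (lor (cone (z 0)) (cone (z 1)) - 2 * lor v (cone (z 0)) * lor v (cone (z 1))) *
      (1 - 2 * lor v (cone (z 0)) * v.2)⁻¹ * (1 - 2 * lor v (cone (z 1)) * v.2)⁻¹ := by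
    simp only [rawCoeff, hexagon, Matrix.cons_val, cone_reflPt hv (hz _), lor_smul_left,
      lor_smul_right, lor_sub_left, lor_sub_right, lor_cone_self (hz _), hv,
      lor_comm (cone (z _)) v, lor_comm (cone (z 1)) (cone (z 0))]
    ring
  refine ⟨?_, hA⟩
  have hB : 2 * lor (cone (z 0)) (cone (z 1)) * lor (cone (z 0)) (cone (reflPt v (z 1))) =
      rawCoeff (hexagon v z) * (1 - 2 * lor v (cone (z 0)) * v.2) := by
    rw [hA]
    simp only [cone_reflPt hv (hz _), lor_smul_right, lor_sub_right, lor_comm (cone (z _)) v]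
    generalize 1 - 2 * lor v (cone (z 0)) * v.2 = k at h0
    have := h0.ne'
    field_simp
  rw [rawVec]
  simp only [hexagon, Matrix.cons_val] at hB ⊢
  rw [hB, cone_reflPt hv (hz 0), smul_smul, mul_assoc, mul_inv_cancel₀ h0.ne']
  module

include hv hz hp hne in
-- Distinct points of the sphere have negative Lorentz product, so both nontrivial factors of the
-- closed formula are negative. Positivity makes the normalised vector v itself and not −v.
theorem rawCoeff_hexagon_pos : 0 < rawCoeff (hexagon v z) := by
  rw [(rawVec_hexagon hv hz).2]
  have h0 := reflPt_denom_pos hv (hz 0)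
  have h1 := reflPt_denom_pos hv (hz 1)
  have h2 := lor_cone_neg (hz 0) (hz 1) hne
  have h3 := mul_pos (hp 0) (hp 1)
  refine mul_pos (mul_pos (mul_pos_of_neg_of_neg (by linarith) (by linarith)) ?_) ?_ <;>
    positivity

include hv hz hp hne in
theorem lor_rawVec_hexagon_pos : 0 < lor (rawVec (hexagon v z)) (rawVec (hexagon v z)) := by
  have h := rawCoeff_hexagon_pos hv hz hp hne
  have h0 := hp 0
  rw [(rawVec_hexagon hv hz).1, lor_smul_left, lor_smul_right, hv]
  positivity

include hv hz hp hne in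
theorem recoverVec_hexagon : recoverVec (hexagon v z) = v := by
  have h := rawCoeff_hexagon_pos hv hz hp hne
  have h0 := hp 0
  have h1 : 0 < 2 * rawCoeff (hexagon v z) * lor v (cone (z 0)) := by positivity
  rw [recoverVec, (rawVec_hexagon hv hz).1, lor_smul_left, lor_smul_right, hv, mul_one,
    Real.sqrt_mul_self h1.le, smul_smul, inv_mul_cancel₀ h1.ne', one_smul]

end Recover

/-- The points of `ParamSpace` which belong to the parameter manifold. -/
structure IsParam (q : ParamSpace) : Prop where
  norm_eq : ‖q.2.1‖ = 1
  injective : Function.Injective q.2.2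

namespace IsParam

variable {q : ParamSpace} (hq : IsParam q)

include hq

theorem lor_self : lor (dsPt q.1 q.2.1) (dsPt q.1 q.2.1) = 1 := lor_dsPt _ hq.norm_eq

theorem norm_cap (i : Fin 3) : ‖capPt q.1 q.2.1 (q.2.2 i)‖ = 1 := norm_capPt _ hq.norm_eq _

theorem lor_cap_pos (i : Fin 3) : 0 < lor (dsPt q.1 q.2.1) (cone (capPt q.1 q.2.1 (q.2.2 i))) := by
  rw [lor_capPt _ hq.norm_eq]
  exact capHeight_pos _ _

theorem coframe_cap (i : Fin 3) :
    (lor (dsPt q.1 q.2.1) (cone (capPt q.1 q.2.1 (q.2.2 i))))⁻¹ •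
      coframe q.2.1 (capPt q.1 q.2.1 (q.2.2 i)) = q.2.2 i := by
  rw [lor_capPt _ hq.norm_eq, coframe_capPt _ hq.norm_eq, inv_smul_smul₀ (capHeight_pos _ _).ne']

theorem cap_injective : Function.Injective fun i => capPt q.1 q.2.1 (q.2.2 i) := by
  intro i j h
  apply hq.injective
  dsimp only at h
  rw [← hq.coframe_cap i, ← hq.coframe_cap j, h]

theorem recoverVec_paramMap : recoverVec (paramMap q) = dsPt q.1 q.2.1 :=
  recoverVec_hexagon hq.lor_self hq.norm_cap hq.lor_cap_pos (hq.cap_injective.ne zero_ne_one)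

/-- With v known, t and u are its de Sitter coordinates, and the even vertices give the points of ℝ³
by the inverse cap chart. -/
theorem recover_paramMap : recover (paramMap q) = q := by
  have hu : (hyp q.1)⁻¹ • hyp q.1 • q.2.1 = q.2.1 := inv_smul_smul₀ (hyp_pos _).ne' _
  rw [recover, hq.recoverVec_paramMap]
  refine Prod.ext rfl (Prod.ext hu ?_)
  funext i
  refine Eq.trans ?_ (hq.coframe_cap i)
  simp only [dsPt, hu]
  fin_cases i <;> rfl

theorem norm_paramMap (i : Fin 6) : ‖paramMap q i‖ = 1 := by
  have h := fun i => norm_reflPt hq.lor_self (hq.norm_cap i)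
  fin_cases i
  exacts [hq.norm_cap 0, h 2, hq.norm_cap 1, h 0, hq.norm_cap 2, h 1]

end IsParam

/-! ### Smoothness of the parametrisation and of its left inverse -/

theorem contDiff_hyp : ContDiff ℝ ∞ hyp :=
  ContDiff.sqrt (by fun_prop) fun t => by positivity

theorem contDiff_capHeight : ContDiff ℝ ∞ fun q : ℝ × Euc 3 => capHeight q.1 q.2 := by
  refine ContDiff.inv (contDiff_fst.add (ContDiff.sqrt ?_ fun q => by positivity))
    fun q => (capHeight_denom_pos q.1 q.2).ne'
  have : ContDiff ℝ ∞ fun q : ℝ × Euc 3 => ‖q.2‖ ^ 2 := contDiff_snd.norm_sq ℝ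
  fun_prop

theorem contDiff_frame : ContDiff ℝ ∞ fun q : Euc 4 × Euc 3 => frame q.1 q.2 := by
  rw [contDiff_euclidean]
  intro i
  fin_cases i <;> simp [frame] <;> fun_prop

theorem contDiff_coframe : ContDiff ℝ ∞ fun q : Euc 4 × Euc 4 => coframe q.1 q.2 := by
  rw [contDiff_euclidean]
  intro i
  fin_cases i <;> simp [coframe] <;> fun_prop

theorem contDiff_lor : ContDiff ℝ ∞ fun q : (Euc 4 × ℝ) × (Euc 4 × ℝ) => lor q.1 q.2 := by
  exact ((contDiff_fst.comp contDiff_fst).inner ℝ (contDiff_fst.comp contDiff_snd)).sub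
    ((contDiff_snd.comp contDiff_fst).mul (contDiff_snd.comp contDiff_snd))

theorem contDiff_cone : ContDiff ℝ ∞ cone := contDiff_id.prodMk contDiff_const

theorem contDiff_dsPt : ContDiff ℝ ∞ fun q : ℝ × Euc 4 => dsPt q.1 q.2 :=
  ((contDiff_hyp.comp contDiff_fst).smul contDiff_snd).prodMk contDiff_fst

theorem contDiff_capPt : ContDiff ℝ ∞ fun q : ℝ × Euc 4 × Euc 3 => capPt q.1 q.2.1 q.2.2 := by
  have h1 : ContDiff ℝ ∞ fun q : ℝ × Euc 4 × Euc 3 => capHeight q.1 q.2.2 :=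
    contDiff_capHeight.comp (contDiff_fst.prodMk (contDiff_snd.comp contDiff_snd))
  have h2 : ContDiff ℝ ∞ fun q : ℝ × Euc 4 × Euc 3 => frame q.2.1 q.2.2 :=
    contDiff_frame.comp contDiff_snd
  have h3 : ContDiff ℝ ∞ fun q : ℝ × Euc 4 × Euc 3 => hyp q.1 := contDiff_hyp.comp contDiff_fst
  exact (((h1.add contDiff_fst).div h3 fun q => (hyp_pos _).ne').smul
    (contDiff_fst.comp contDiff_snd)).add (h1.smul h2)

theorem contDiffAt_reflPt {p : (Euc 4 × ℝ) × Euc 4}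
    (h : 1 - 2 * lor p.1 (cone p.2) * p.1.2 ≠ 0) :
    ContDiffAt ℝ ∞ (fun q : (Euc 4 × ℝ) × Euc 4 => reflPt q.1 q.2) p := by
  have h1 : ContDiff ℝ ∞ fun q : (Euc 4 × ℝ) × Euc 4 => lor q.1 (cone q.2) :=
    contDiff_lor.comp (contDiff_fst.prodMk (contDiff_cone.comp contDiff_snd))
  have h2 : ContDiff ℝ ∞ fun q : (Euc 4 × ℝ) × Euc 4 => 1 - 2 * lor q.1 (cone q.2) * q.1.2 := by
    fun_prop
  have h3 : ContDiff ℝ ∞ fun q : (Euc 4 × ℝ) × Euc 4 => q.2 - (2 * lor q.1 (cone q.2)) • q.1.1 := by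
    fun_prop
  exact (h2.contDiffAt.inv h).smul h3.contDiffAt

theorem contDiff_paramCap (i : Fin 3) :
    ContDiff ℝ ∞ fun q : ParamSpace => capPt q.1 q.2.1 (q.2.2 i) := by
  have h : ContDiff ℝ ∞ fun q : ParamSpace => q.2.2 i :=
    (contDiff_apply ℝ (Euc 3) i).comp (contDiff_snd.comp contDiff_snd)
  exact contDiff_capPt.comp (f := fun q : ParamSpace => (q.1, q.2.1, q.2.2 i))
    (contDiff_fst.prodMk ((contDiff_fst.comp contDiff_snd).prodMk h))

theorem contDiff_paramVec : ContDiff ℝ ∞ fun q : ParamSpace => dsPt q.1 q.2.1 :=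
  contDiff_dsPt.comp (f := fun q : ParamSpace => (q.1, q.2.1))
    (contDiff_fst.prodMk (contDiff_fst.comp contDiff_snd))

theorem IsParam.contDiffAt_reflPt {q : ParamSpace} (hq : IsParam q) (i : Fin 3) :
    ContDiffAt ℝ ∞ (fun q : ParamSpace =>
      reflPt (dsPt q.1 q.2.1) (capPt q.1 q.2.1 (q.2.2 i))) q := by
  have h := _root_.contDiffAt_reflPt (p := (dsPt q.1 q.2.1, capPt q.1 q.2.1 (q.2.2 i)))
    (reflPt_denom_pos hq.lor_self (hq.norm_cap i)).ne'
  exact ContDiffAt.comp (g := fun q : (Euc 4 × ℝ) × Euc 4 => reflPt q.1 q.2)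
    (f := fun q : ParamSpace => (dsPt q.1 q.2.1, capPt q.1 q.2.1 (q.2.2 i))) q h
    (contDiff_paramVec.prodMk (contDiff_paramCap i)).contDiffAt

theorem IsParam.contDiffAt_paramMap {q : ParamSpace} (hq : IsParam q) :
    ContDiffAt ℝ ∞ paramMap q := by
  rw [contDiffAt_pi]
  intro i
  have hc := fun i => (contDiff_paramCap i).contDiffAt (x := q)
  fin_cases i
  exacts [hc 0, hq.contDiffAt_reflPt 2, hc 1, hq.contDiffAt_reflPt 0, hc 2, hq.contDiffAt_reflPt 1]

theorem contDiff_rawVec : ContDiff ℝ ∞ rawVec := by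
  have hc (i : Fin 6) : ContDiff ℝ ∞ fun x : Fin 6 → Euc 4 => cone (x i) :=
    contDiff_cone.comp (contDiff_apply ℝ _ i)
  have hl (i j : Fin 6) : ContDiff ℝ ∞ fun x : Fin 6 → Euc 4 => lor (cone (x i)) (cone (x j)) :=
    contDiff_lor.comp ((hc i).prodMk (hc j))
  unfold rawVec rawCoeff
  fun_prop

theorem contDiffAt_recoverVec {x : Fin 6 → Euc 4} (hx : 0 < lor (rawVec x) (rawVec x)) :
    ContDiffAt ℝ ∞ recoverVec x := by
  have h := contDiff_lor.comp (contDiff_rawVec.prodMk contDiff_rawVec)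
  exact ((h.contDiffAt.sqrt hx.ne').inv (Real.sqrt_pos.2 hx).ne').smul contDiff_rawVec.contDiffAt

theorem contDiffAt_recover {x : Fin 6 → Euc 4} (hx : 0 < lor (rawVec x) (rawVec x))
    (h : ∀ i, lor (recoverVec x) (cone (x (![0, 2, 4] i))) ≠ 0) :
    ContDiffAt ℝ ∞ recover x := by
  have hv := contDiffAt_recoverVec hx
  have ht : ContDiffAt ℝ ∞ (fun x => (recoverVec x).2) x := contDiffAt_snd.comp x hv
  have hu : ContDiffAt ℝ ∞ (fun x => (hyp (recoverVec x).2)⁻¹ • (recoverVec x).1) x :=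
    ((contDiff_hyp.contDiffAt.comp x ht).inv (hyp_pos _).ne').smul (contDiffAt_fst.comp x hv)
  refine ht.prodMk (hu.prodMk ?_)
  rw [contDiffAt_pi]
  intro i
  have hi : ContDiffAt ℝ ∞ (fun x : Fin 6 → Euc 4 => x (![0, 2, 4] i)) x :=
    (contDiff_apply ℝ _ _).contDiffAt
  have hb : ContDiffAt ℝ ∞
      (fun x : Fin 6 → Euc 4 => lor (recoverVec x) (cone (x (![0, 2, 4] i)))) x :=
    contDiff_lor.contDiffAt.comp x (hv.prodMk (contDiff_cone.contDiffAt.comp x hi))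
  exact (hb.inv (h i)).smul (contDiff_coframe.contDiffAt.comp x (hu.prodMk hi))

theorem IsParam.contDiffAt_recover {q : ParamSpace} (hq : IsParam q) :
    ContDiffAt ℝ ∞ recover (paramMap q) := by
  refine _root_.contDiffAt_recover (lor_rawVec_hexagon_pos hq.lor_self hq.norm_cap hq.lor_cap_pos
    (hq.cap_injective.ne zero_ne_one)) fun i => ?_
  rw [hq.recoverVec_paramMap]
  have := fun i => (hq.lor_cap_pos i).ne'
  fin_cases i
  exacts [this 0, this 1, this 2]

/-! ### Distinctness of the six points -/

theorem reflPt_inj {v : Euc 4 × ℝ} (hv : lor v v = 1) {x y : Euc 4} (hx : ‖x‖ = 1)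
    (hy : ‖y‖ = 1) (h : reflPt v x = reflPt v y) : x = y := by
  have kx := (reflPt_denom_pos hv hx).ne'
  have ky := (reflPt_denom_pos hv hy).ne'
  have h1 := lor_reflPt hv hx
  have h2 : cone (reflPt v x) = cone (reflPt v y) := congrArg cone h
  rw [h, lor_reflPt hv hy, neg_inj] at h1
  rw [cone_reflPt hv hx, cone_reflPt hv hy] at h2
  generalize 1 - 2 * lor v (cone x) * v.2 = a at *
  generalize 1 - 2 * lor v (cone y) * v.2 = b at *
  -- Equal images have equal `lor v`, so adding the same multiple of v undoes both reflections. The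
  -- last coordinate of a cone vector is 1, which then forces equal scale factors.
  have h3 : a⁻¹ • cone x = b⁻¹ • cone y := by
    calc a⁻¹ • cone x = a⁻¹ • (cone x - (2 * lor v (cone x)) • v)
          + (2 * (a⁻¹ * lor v (cone x))) • v := by module
      _ = b⁻¹ • cone y := by rw [h2, ← h1]; module
  have h4 : a⁻¹ = b⁻¹ := by simpa [cone] using congrArg Prod.snd h3
  rw [h4] at h3
  exact congrArg Prod.fst (smul_right_injective _ (inv_ne_zero ky) h3)

theorem reflPt_ne_of_pos {v : Euc 4 × ℝ} (hv : lor v v = 1) {x y : Euc 4} (hx : ‖x‖ = 1)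
    (hbx : 0 < lor v (cone x)) (hby : 0 < lor v (cone y)) : y ≠ reflPt v x := by
  rintro rfl
  rw [lor_reflPt hv hx] at hby
  have := inv_pos.2 (reflPt_denom_pos hv hx)
  have := mul_pos this hbx
  linarith

theorem hexagon_injective {v : Euc 4 × ℝ} (hv : lor v v = 1) {z : Fin 3 → Euc 4}
    (hz : ∀ i, ‖z i‖ = 1) (hp : ∀ i, 0 < lor v (cone (z i))) (hi : Function.Injective z) :
    Function.Injective (hexagon v z) := by
  have h0 {i j} (h : z i = z j) : i = j := hi h
  have h1 {i j} (h : reflPt v (z i) = reflPt v (z j)) : i = j := hi (reflPt_inj hv (hz i) (hz j) h)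
  have h2 (i j) (h : z j = reflPt v (z i)) : False := reflPt_ne_of_pos hv (hz i) (hp i) (hp j) h
  intro i j h
  fin_cases i <;> fin_cases j <;> first
    | rfl
    | exact (h2 _ _ h).elim
    | exact (h2 _ _ h.symm).elim
    | exact absurd (h0 h) (by decide)
    | exact absurd (h1 h) (by decide)

theorem IsParam.injective_paramMap {q : ParamSpace} (hq : IsParam q) :
    Function.Injective (paramMap q) :=
  hexagon_injective hq.lor_self hq.norm_cap hq.lor_cap_pos hq.cap_injective

/-! ### The parameter manifold and its immersion in the configuration space -/

instance fact_finrank_euc4 : Fact (Module.finrank ℝ (Euc 4) = 3 + 1) := ⟨by simp⟩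

/-- The parameter manifold. -/
abbrev ParamManifold : Type := ℝ × S3 × Conf 3 (Euc 3)

/-- The model of the parameter manifold. -/
noncomputable abbrev paramModel := 𝓘(ℝ, ℝ).prod ((𝓡 3).prod modelConf3)

/-- The inclusion of the parameter manifold in a vector space. -/
def paramIncl (n : ParamManifold) : ParamSpace := (n.1, (n.2.1 : Euc 4), (n.2.2 : Fin 3 → Euc 3))

theorem isParam_paramIncl (n : ParamManifold) : IsParam (paramIncl n) :=
  ⟨by simp [paramIncl], n.2.2.2⟩

theorem IsParam.exists_paramIncl {q : ParamSpace} (hq : IsParam q) :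
    ∃ n : ParamManifold, paramIncl n = q :=
  ⟨(q.1, ⟨q.2.1, by simpa using hq.norm_eq⟩, ⟨q.2.2, hq.injective⟩), rfl⟩

theorem isEmbedding_paramIncl : Topology.IsEmbedding paramIncl :=
  Topology.IsEmbedding.id.prodMap (Topology.IsEmbedding.subtypeVal.prodMap
    Topology.IsEmbedding.subtypeVal)

theorem contMDiff_confVal :
    ContMDiff modelConf3 𝓘(ℝ, Fin 3 → Euc 3) ∞ fun z : Conf 3 (Euc 3) => (z : Fin 3 → Euc 3) := by
  rw [contMDiff_pi_space]
  intro i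
  exact (contMDiff_pi_apply (I := fun _ => 𝓡 3) (M := fun _ => Euc 3) i).comp
    contMDiff_subtype_val

theorem contMDiff_paramIncl : ContMDiff paramModel 𝓘(ℝ, ParamSpace) ∞ paramIncl := by
  refine ContMDiff.prodMk_space contMDiff_fst (ContMDiff.prodMk_space ?_ ?_)
  · exact (contMDiff_coe_sphere (E := Euc 4)).comp (contMDiff_fst.comp contMDiff_snd)
  · exact contMDiff_confVal.comp (contMDiff_snd.comp contMDiff_snd)

/-- The inclusion of an open subset of a vector space is the identity in the charts. -/
theorem injective_mfderiv_confVal (q : Conf 3 (Euc 3)) : Function.Injective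
    (mfderiv modelConf3 𝓘(ℝ, Fin 3 → Euc 3)
      (fun z : Conf 3 (Euc 3) => (z : Fin 3 → Euc 3)) q) := by
  have h : MDifferentiableAt modelConf3 𝓘(ℝ, Fin 3 → Euc 3)
      (fun z : Conf 3 (Euc 3) => (z : Fin 3 → Euc 3)) q :=
    (contMDiff_confVal q).mdifferentiableAt (by simp)
  have he : writtenInExtChartAt modelConf3 𝓘(ℝ, Fin 3 → Euc 3) q
      (fun z : Conf 3 (Euc 3) => (z : Fin 3 → Euc 3)) =ᶠ[nhdsWithin (extChartAt modelConf3 q q)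
        (Set.range modelConf3)] id := by
    filter_upwards [extChartAt_target_mem_nhdsWithin (I := modelConf3) q] with y hy
    exact (extChartAt modelConf3 q).right_inv hy
  rw [h.mfderiv, he.fderivWithin_eq (he.self_of_nhdsWithin ⟨_, rfl⟩), fderivWithin_id]
  · exact Function.injective_id
  · rw [ModelWithCorners.range_eq_univ]
    exact uniqueDiffWithinAt_univ

theorem mfderiv_clm_comp_paramIncl {V : Type*} [NormedAddCommGroup V] [NormedSpace ℝ V]
    (P : ParamSpace →L[ℝ] V) (n : ParamManifold) (ξ : TangentSpace paramModel n) :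
    mfderiv paramModel 𝓘(ℝ, V) (fun n => P (paramIncl n)) n ξ =
      P (mfderiv paramModel 𝓘(ℝ, ParamSpace) paramIncl n ξ) := by
  have hi : MDifferentiableAt paramModel 𝓘(ℝ, ParamSpace) paramIncl n :=
    (contMDiff_paramIncl n).mdifferentiableAt (by simp)
  have h := mfderiv_comp n (g := (P : ParamSpace → V)) P.mdifferentiableAt hi
  rw [ContinuousLinearMap.mfderiv_eq] at h
  exact congrArg (fun f => f ξ) h

/-- Tangent vectors are compared one factor at a time, by composing the inclusion with the three
linear projections of `ParamSpace`. -/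
theorem injective_mfderiv_paramIncl (n : ParamManifold) :
    Function.Injective (mfderiv paramModel 𝓘(ℝ, ParamSpace) paramIncl n) := by
  intro ξ η h
  have key {V : Type} [NormedAddCommGroup V] [NormedSpace ℝ V] (P : ParamSpace →L[ℝ] V) :
      mfderiv paramModel 𝓘(ℝ, V) (fun n => P (paramIncl n)) n ξ =
        mfderiv paramModel 𝓘(ℝ, V) (fun n => P (paramIncl n)) n η := by
    rw [mfderiv_clm_comp_paramIncl, mfderiv_clm_comp_paramIncl, h]
  have hs : MDifferentiableAt ((𝓡 3).prod modelConf3) (𝓡 3)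
      (Prod.fst : S3 × Conf 3 (Euc 3) → S3) n.2 := mdifferentiableAt_fst
  have hc : MDifferentiableAt ((𝓡 3).prod modelConf3) modelConf3
      (Prod.snd : S3 × Conf 3 (Euc 3) → Conf 3 (Euc 3)) n.2 := mdifferentiableAt_snd
  have hn : MDifferentiableAt paramModel ((𝓡 3).prod modelConf3)
      (Prod.snd : ParamManifold → S3 × Conf 3 (Euc 3)) n := mdifferentiableAt_snd
  have h1 : ξ.1 = η.1 := by
    have h := key (ContinuousLinearMap.fst ℝ ℝ (Euc 4 × (Fin 3 → Euc 3)))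
    have hf := mfderiv_fst (I := 𝓘(ℝ, ℝ)) (I' := (𝓡 3).prod modelConf3) (x := n)
    exact (congrArg (fun f => f ξ) hf).symm.trans (h.trans (congrArg (fun f => f η) hf))
  have h2 : ξ.2.1 = η.2.1 := by
    have h := key ((ContinuousLinearMap.fst ℝ (Euc 4) (Fin 3 → Euc 3)).comp
      (ContinuousLinearMap.snd ℝ ℝ (Euc 4 × (Fin 3 → Euc 3))))
    have hv : MDifferentiableAt (𝓡 3) 𝓘(ℝ, Euc 4) (fun x : S3 => (x : Euc 4)) n.2.1 :=
      (contMDiff_coe_sphere (m := 1) _).mdifferentiableAt (by simp)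
    have hf := (mfderiv_comp n hv (hs.comp n hn)).trans
      (congrArg _ ((mfderiv_comp n hs hn).trans (congrArg₂ _ mfderiv_fst mfderiv_snd)))
    refine injective_mvfderiv_subtypeVal_sphere n.2.1 ?_
    exact (congrArg (fun f => f ξ) hf).symm.trans (h.trans (congrArg (fun f => f η) hf))
  have h3 : ξ.2.2 = η.2.2 := by
    have h := key ((ContinuousLinearMap.snd ℝ (Euc 4) (Fin 3 → Euc 3)).comp
      (ContinuousLinearMap.snd ℝ ℝ (Euc 4 × (Fin 3 → Euc 3))))
    have hv : MDifferentiableAt modelConf3 𝓘(ℝ, Fin 3 → Euc 3)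
        (fun z : Conf 3 (Euc 3) => (z : Fin 3 → Euc 3)) n.2.2 :=
      (contMDiff_confVal _).mdifferentiableAt (by simp)
    have hf := (mfderiv_comp n hv (hc.comp n hn)).trans
      (congrArg _ ((mfderiv_comp n hc hn).trans (congrArg₂ _ mfderiv_snd mfderiv_snd)))
    refine injective_mfderiv_confVal n.2.2 ?_
    exact (congrArg (fun f => f ξ) hf).symm.trans (h.trans (congrArg (fun f => f η) hf))
  exact Prod.ext h1 (Prod.ext h2 h3)

theorem contMDiff_paramMap :
    ContMDiff paramModel 𝓘(ℝ, Fin 6 → Euc 4) ∞ (paramMap ∘ paramIncl) := fun n =>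
  (isParam_paramIncl n).contDiffAt_paramMap.contMDiffAt.comp n (contMDiff_paramIncl n)

/-- The parametrisation of the image of the moduli space in the configuration space. -/
noncomputable def paramConf (n : ParamManifold) : Conf 6 S3 :=
  ⟨fun i => ⟨paramMap (paramIncl n) i, by simpa using (isParam_paramIncl n).norm_paramMap i⟩,
    fun _ _ h => (isParam_paramIncl n).injective_paramMap (congrArg Subtype.val h)⟩

theorem contMDiff_paramConf : ContMDiff paramModel modelConf6 ∞ paramConf := by
  rw [← ContMDiff.subtypeVal_comp_iff]
  refine contMDiff_pi_of_forall (I := fun _ => 𝓡 3) fun i => ?_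
  exact ContMDiff.codRestrict_sphere (contMDiff_pi_space.1 contMDiff_paramMap i) _

/-- The six points of a configuration, as vectors. -/
def confVec (x : Conf 6 S3) : Fin 6 → Euc 4 := fun i => (x.1 i : Euc 4)

theorem contMDiff_confVec : ContMDiff modelConf6 𝓘(ℝ, Fin 6 → Euc 4) ∞ confVec := by
  rw [contMDiff_pi_space]
  intro i
  exact (contMDiff_coe_sphere (E := Euc 4)).comp
    ((contMDiff_pi_apply (I := fun _ => 𝓡 3) (M := fun _ => S3) i).comp contMDiff_subtype_val)

/-- By the chain rule, a differentiable left inverse up to the immersion `paramIncl` makes the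
differential injective. -/
theorem injective_mfderiv_paramConf (n : ParamManifold) :
    Function.Injective (mfderiv paramModel modelConf6 paramConf n) := by
  have hn := isParam_paramIncl n
  have h1 : recover ∘ confVec ∘ paramConf = paramIncl :=
    funext fun n => (isParam_paramIncl n).recover_paramMap
  have h2 := injective_mfderiv_paramIncl n
  have hc : MDifferentiableAt modelConf6 𝓘(ℝ, Fin 6 → Euc 4) confVec (paramConf n) :=
    (contMDiff_confVec _).mdifferentiableAt (by simp)
  have hp : MDifferentiableAt paramModel modelConf6 paramConf n :=
    (contMDiff_paramConf _).mdifferentiableAt (by simp)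
  have hr : MDifferentiableAt 𝓘(ℝ, Fin 6 → Euc 4) 𝓘(ℝ, ParamSpace) recover
      (confVec (paramConf n)) :=
    hn.contDiffAt_recover.contMDiffAt.mdifferentiableAt (by simp)
  rw [← h1, mfderiv_comp n hr (hc.comp n hp), mfderiv_comp n hc hp] at h2
  exact (Function.Injective.of_comp (f := fun y => mfderiv 𝓘(ℝ, Fin 6 → Euc 4) 𝓘(ℝ, ParamSpace) recover
      (confVec (paramConf n)) (mfderiv modelConf6 𝓘(ℝ, Fin 6 → Euc 4) confVec (paramConf n) y)) h2)

theorem confVec_paramConf (n : ParamManifold) : confVec (paramConf n) = paramMap (paramIncl n) := rfl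

theorem injective_confVec : Function.Injective confVec := fun _ _ h =>
  Subtype.ext (funext fun i => Subtype.ext (congrFun h i))

theorem paramConf_injective : Function.Injective paramConf := fun n n' h =>
  isEmbedding_paramIncl.injective <| by
    rw [← (isParam_paramIncl n).recover_paramMap, ← (isParam_paramIncl n').recover_paramMap,
      ← confVec_paramConf, h, confVec_paramConf]

/-! ### From a bijection to a diffeomorphism -/

/-- A bijection compatible with the maps to the configuration space is a homeomorphism. -/
noncomputable def moduliHomeomorph {c : Euc 4} {r : ℝ} (e : Moduli c r ≃ ParamManifold)
    (he : ∀ m, m.label = paramConf (e m)) : Moduli c r ≃ₜ ParamManifold where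
  toEquiv := e
  continuous_toFun := by
    rw [isEmbedding_paramIncl.continuous_iff, continuous_iff_continuousAt]
    intro m
    -- The parameters are read off from the labelled points by `recover`, which is continuous at
    -- points of the image. As M has the topology induced by the labels, this gives continuity.
    have h : paramIncl ∘ e = recover ∘ confVec ∘ Moduli.label := by
      funext m
      simp [he, confVec_paramConf, (isParam_paramIncl (e m)).recover_paramMap]
    have hr : ContinuousAt recover (confVec (Moduli.label m)) := by
      rw [he, confVec_paramConf]
      exact (isParam_paramIncl (e m)).contDiffAt_recover.continuousAt
    change ContinuousAt (paramIncl ∘ e) m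
    rw [h]
    exact ContinuousAt.comp hr
      (contMDiff_confVec.continuous.comp continuous_induced_dom).continuousAt
  continuous_invFun := by
    rw [continuous_induced_rng]
    have : Moduli.label ∘ e.symm = paramConf := by
      funext n
      simp [he]
    exact this ▸ contMDiff_paramConf.continuous

theorem finrank_paramSpace : Module.finrank ℝ (ℝ × Euc 3 × (Fin 3 → Euc 3)) = 13 := by
  simp [Module.finrank_prod, Module.finrank_pi_fintype]

theorem exists_manifold_of_equiv {c : Euc 4} {r : ℝ} (e : Moduli c r ≃ ParamManifold)
    (he : ∀ m, m.label = paramConf (e m)) :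
    ∃ (_ : ChartedSpace (Euc 13) (Moduli c r)) (_ : IsManifold (𝓡 13) ∞ (Moduli c r)),
      (Topology.IsEmbedding (Moduli.label (c := c) (r := r)) ∧
        ContMDiff (𝓡 13) modelConf6 ∞ (Moduli.label (c := c) (r := r)) ∧
        ∀ m : Moduli c r,
          Function.Injective (mfderiv (𝓡 13) modelConf6 (Moduli.label (c := c) (r := r)) m)) ∧
      Nonempty (Moduli c r ≃ₘ^∞⟮𝓡 13, 𝓘(ℝ, ℝ).prod ((𝓡 3).prod modelConf3)⟯
        (ℝ × S3 × Conf 3 (Euc 3))) := by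
  let φ := moduliHomeomorph e he
  let L : (ℝ × Euc 3 × (Fin 3 → Euc 3)) ≃L[ℝ] Euc 13 :=
    ContinuousLinearEquiv.ofFinrankEq (finrank_paramSpace.trans (by simp))
  let _ : ChartedSpace (Euc 13) (Moduli c r) :=
    transportChartedSpace φ (paramModel.toHomeomorph.trans L.toHomeomorph)
  have hφ := contMDiff_transport (I := paramModel) (n := ∞) φ L
  let Φ : Moduli c r ≃ₘ^∞⟮𝓡 13, paramModel⟯ ParamManifold := ⟨e, hφ.1, hφ.2⟩
  have hl : Moduli.label (c := c) (r := r) = paramConf ∘ Φ := funext he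
  have hM : IsManifold (𝓡 13) ∞ (Moduli c r) := isManifold_transport (I := paramModel) φ L
  refine ⟨_, hM, ⟨⟨⟨rfl⟩, ?_⟩, ?_, fun m => ?_⟩, ⟨Φ⟩⟩
  · rw [hl]
    exact paramConf_injective.comp e.injective
  · rw [hl]
    exact contMDiff_paramConf.comp Φ.contMDiff
  · rw [hl, mfderiv_comp m ((contMDiff_paramConf _).mdifferentiableAt (by simp))
      (Φ.contMDiff.mdifferentiable (by simp) m)]
    exact (injective_mfderiv_paramConf _).comp (Φ.mfderivToContinuousLinearEquiv (by simp) m).injective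

/-! ### Reduction to the unit ball; points outside the ball -/

/-- The linear automorphism of the space of homogeneous coordinates which carries the unit ball
to the ball with centre `c` and radius `r`. -/
noncomputable def ballEquiv (c : Euc 4) {r : ℝ} (hr : r ≠ 0) : (Euc 4 × ℝ) ≃ₗ[ℝ] (Euc 4 × ℝ) where
  toFun v := (r • v.1 + v.2 • c, v.2)
  map_add' v w := by ext1 <;> simp only [Prod.fst_add, Prod.snd_add, Prod.mk_add_mk]; module
  map_smul' s v := by
    ext1 <;> simp only [Prod.smul_fst, Prod.smul_snd, RingHom.id_apply, Prod.smul_mk, smul_eq_mul]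
    module
  invFun v := (r⁻¹ • (v.1 - v.2 • c), v.2)
  left_inv v := by
    ext1 <;> simp [inv_smul_smul₀ hr]
  right_inv v := by
    ext1 <;> simp [smul_inv_smul₀ hr]

theorem norm_S3 (x : S3) : ‖(x : Euc 4)‖ = 1 := by simp

section Projective

variable (c : Euc 4) {r : ℝ} (hr : r ≠ 0)

theorem ballEquiv_cone (x : Euc 4) : ballEquiv c hr (cone x) = (c + r • x, (1 : ℝ)) := by
  simp [ballEquiv, cone, add_comm]

theorem submodule_affinePt (x : Euc 4) :
    (affinePt (c + r • x)).submodule = Submodule.span ℝ {ballEquiv c hr (cone x)} := by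
  rw [affinePt, Projectivization.submodule_mk, ballEquiv_cone]

theorem submodule_bdry_le {W : Submodule ℝ (Euc 4 × ℝ)} (x : S3) :
    (bdry c r x).submodule ≤ W ↔ ballEquiv c hr (cone x) ∈ W := by
  rw [bdry, submodule_affinePt c hr, Submodule.span_singleton_le_iff_mem]

include hr in
theorem bdry_injective : Function.Injective (bdry c r) := by
  intro x y h
  have h1 : ballEquiv c hr (cone x) ∈ Submodule.span ℝ {ballEquiv c hr (cone y)} := by
    rw [← submodule_affinePt c hr]
    exact (submodule_bdry_le c hr x).1 (by rw [h]; rfl)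
  obtain ⟨a, ha⟩ := Submodule.mem_span_singleton.1 h1
  rw [← map_smul] at ha
  have h2 := (ballEquiv c hr).injective ha
  have h3 : a = 1 := by simpa [cone] using congrArg Prod.snd h2
  rw [h3, one_smul] at h2
  exact Subtype.ext (congrArg Prod.fst h2).symm

/-- The point of projective space with coordinates `v`, after the coordinate change that carries
the unit ball to the given ball. -/
def IsPoint (v : Euc 4 × ℝ) (p : RP4) : Prop :=
  p.submodule = Submodule.span ℝ {ballEquiv c hr v}

theorem ne_zero_of_lor {v : Euc 4 × ℝ} (hv : lor v v = 1) : v ≠ 0 := by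
  rintro rfl
  simp [lor] at hv

theorem exists_isPoint {v : Euc 4 × ℝ} (hv : v ≠ 0) : ∃ p, IsPoint c hr v p :=
  ⟨Projectivization.mk ℝ (ballEquiv c hr v) ((ballEquiv c hr).map_ne_zero_iff.2 hv),
    Projectivization.submodule_mk _ _⟩

variable {c hr}

theorem IsPoint.unique {v : Euc 4 × ℝ} {p p' : RP4} (h : IsPoint c hr v p)
    (h' : IsPoint c hr v p') : p = p' :=
  Projectivization.submodule_injective (h.trans h'.symm)

theorem IsPoint.smul {v : Euc 4 × ℝ} {p : RP4} (h : IsPoint c hr v p) {a : ℝ} (ha : a ≠ 0) :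
    IsPoint c hr (a • v) p := by
  rw [IsPoint, h, map_smul, Submodule.span_singleton_smul_eq ha.isUnit]

/-- The Lorentz form is nonpositive on every vector representing a point of the closed unit ball. -/
theorem IsPoint.notMem_ball4 {v : Euc 4 × ℝ} (hv : lor v v = 1) {p : RP4}
    (h : IsPoint c hr v p) (hr0 : 0 < r) : p ∉ ball4 c r := by
  rintro ⟨y, hy, rfl⟩
  obtain ⟨x, rfl⟩ : ∃ x, y = c + r • x := ⟨r⁻¹ • (y - c), by simp [smul_inv_smul₀ hr]⟩
  have h1 : ballEquiv c hr v ∈ Submodule.span ℝ {ballEquiv c hr (cone x)} := by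
    rw [← submodule_affinePt c hr, h]
    exact Submodule.mem_span_singleton_self _
  obtain ⟨a, ha⟩ := Submodule.mem_span_singleton.1 h1
  rw [← map_smul] at ha
  rw [← (ballEquiv c hr).injective ha, lor_smul_left, lor_smul_right, lor_cone_cone,
    real_inner_self_eq_norm_sq] at hv
  rw [mem_closedBall_iff_norm, add_sub_cancel_left, norm_smul, Real.norm_of_nonneg hr0.le,
    mul_le_iff_le_one_right hr0] at hy
  nlinarith [norm_nonneg x, mul_self_nonneg a, pow_le_one₀ (n := 2) (norm_nonneg x) hy]

theorem exists_lor_eq_one_of_notMem_ball4 (hr0 : 0 < r) {p : RP4} (hp : p ∉ ball4 c r) :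
    ∃ v, lor v v = 1 ∧ IsPoint c hr v p := by
  obtain ⟨v, hv⟩ : ∃ v, ballEquiv c hr v = p.rep := (ballEquiv c hr).surjective _
  have h : IsPoint c hr v p := by rw [IsPoint, hv, Projectivization.submodule_eq]
  have hv0 : v ≠ 0 := by
    rintro rfl
    exact p.rep_nonzero (by rw [← hv, map_zero])
  suffices hpos : 0 < lor v v by
    refine ⟨(√(lor v v))⁻¹ • v, ?_, h.smul (inv_ne_zero (Real.sqrt_pos.2 hpos).ne')⟩
    rw [lor_smul_left, lor_smul_right, ← mul_assoc, ← mul_inv, Real.mul_self_sqrt hpos.le,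
      inv_mul_cancel₀ hpos.ne']
  by_contra! hneg
  simp only [lor, real_inner_self_eq_norm_sq] at hneg
  -- A nonzero vector with nonpositive Lorentz square is not at infinity. Dividing by its last
  -- coordinate gives a point of the closed unit ball.
  have ht : v.2 ≠ 0 := by
    intro ht
    rw [ht] at hneg
    apply hv0
    ext1
    · exact norm_eq_zero.1 (pow_eq_zero_iff two_ne_zero |>.1 (by nlinarith [sq_nonneg ‖v.1‖]))
    · exact ht
  apply hp
  refine ⟨c + r • v.2⁻¹ • v.1, ?_, ?_⟩
  · rw [mem_closedBall_iff_norm, add_sub_cancel_left, norm_smul, Real.norm_of_nonneg hr0.le,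
      mul_le_iff_le_one_right hr0, norm_smul, norm_inv, inv_mul_le_one₀ (norm_pos_iff.2 ht)]
    exact abs_le_of_sq_le_sq' (by rw [Real.norm_eq_abs, sq_abs]; linarith) (norm_nonneg _) |>.2
  · refine IsPoint.unique (c := c) (hr := hr) (v := v.2⁻¹ • v) ?_ (h.smul (inv_ne_zero ht))
    rw [IsPoint, submodule_affinePt c hr]
    congr 3
    ext1
    · rfl
    · exact (inv_mul_cancel₀ ht).symm

end Projective

/-! ### Lines through an exterior point, tangency and sides -/

/-- The involution of the sphere defined by a vector of de Sitter space. -/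
noncomputable def reflS {v : Euc 4 × ℝ} (hv : lor v v = 1) (x : S3) : S3 :=
  ⟨reflPt v x, by simpa using norm_reflPt hv (norm_S3 x)⟩

theorem reflS_eq_self_iff {v : Euc 4 × ℝ} (hv : lor v v = 1) {x : S3} :
    reflS hv x = x ↔ lor v (cone x) = 0 := by
  constructor
  · intro h
    have h1 := lor_reflPt hv (norm_S3 x)
    have h2 : reflPt v x = x := congrArg Subtype.val h
    have h3 := inv_pos.2 (reflPt_denom_pos hv (norm_S3 x))
    rw [h2] at h1
    have h4 : (1 + (1 - 2 * lor v (cone x) * v.2)⁻¹) * lor v (cone x) = 0 := by linarith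
    exact (mul_eq_zero.1 h4).resolve_left (by positivity)
  · intro h
    apply Subtype.ext
    simp [reflS, reflPt, h]

theorem linearIndependent_cone {v : Euc 4 × ℝ} (hv : lor v v = 1) (x : S3) :
    LinearIndependent ℝ ![v, cone x] := by
  rw [LinearIndependent.pair_iff]
  intro a b h
  -- A multiple of v that is also a multiple of a lightlike vector has Lorentz square 0.
  have h1 : a ^ 2 = 0 := by
    have h2 : a • v = -(b • cone x) := eq_neg_of_add_eq_zero_left h
    have h3 : lor (a • v) (a • v) = 0 := by
      rw [h2, ← neg_smul, lor_smul_left, lor_smul_right, lor_cone_self (norm_S3 x)]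
      ring
    rw [lor_smul_left, lor_smul_right, hv] at h3
    linarith
  have h4 : a = 0 := pow_eq_zero_iff two_ne_zero |>.1 h1
  rw [h4, zero_smul, zero_add] at h
  exact ⟨h4, by simpa [cone] using congrArg Prod.snd h⟩

/-- The line through `[v]` and the point `x` of the sphere. -/
def lineThru (c : Euc 4) {r : ℝ} (hr : r ≠ 0) (v : Euc 4 × ℝ) (x : S3) : Set RP4 :=
  {q | q.submodule ≤ (Submodule.span ℝ {v, cone x}).map (ballEquiv c hr).toLinearMap}

section Lines

variable {c : Euc 4} {r : ℝ} {hr : r ≠ 0} {v : Euc 4 × ℝ} (hv : lor v v = 1)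

include hv in
theorem finrank_span_pair (x : S3) :
    Module.finrank ℝ ((Submodule.span ℝ {v, cone x}).map (ballEquiv c hr).toLinearMap) = 2 := by
  rw [LinearEquiv.finrank_map_eq]
  have h := finrank_span_eq_card (linearIndependent_cone hv x)
  rwa [Matrix.range_cons, Matrix.range_cons, Matrix.range_empty, Set.union_empty,
    Set.singleton_union, Fintype.card_fin] at h

include hv in
theorem isLine_lineThru (x : S3) : IsLine (lineThru c hr v x) :=
  ⟨_, finrank_span_pair hv x, rfl⟩

theorem IsPoint.mem_lineThru {p : RP4} (hp : IsPoint c hr v p) (x : S3) :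
    p ∈ lineThru c hr v x := by
  change p.submodule ≤ _
  rw [hp, Submodule.span_singleton_le_iff_mem]
  exact Submodule.mem_map_of_mem (Submodule.subset_span (by simp))

theorem bdry_mem_lineThru_iff_mem {x y : S3} :
    bdry c r y ∈ lineThru c hr v x ↔ cone y ∈ Submodule.span ℝ {v, cone x} := by
  change (bdry c r y).submodule ≤ _ ↔ _
  rw [submodule_bdry_le c hr]
  exact (ballEquiv c hr).injective.mem_set_image

theorem bdry_mem_lineThru_self (x : S3) : bdry c r x ∈ lineThru c hr v x :=
  bdry_mem_lineThru_iff_mem.2 (Submodule.subset_span (by simp))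

include hv in
theorem IsLine.eq_lineThru {p : RP4} (hp : IsPoint c hr v p) {ℓ : Set RP4} (hℓ : IsLine ℓ)
    (hpℓ : p ∈ ℓ) {x : S3} (hx : bdry c r x ∈ ℓ) : ℓ = lineThru c hr v x := by
  obtain ⟨W, hW, rfl⟩ := hℓ
  have h : (Submodule.span ℝ {v, cone x}).map (ballEquiv c hr).toLinearMap = W := by
    apply Submodule.eq_of_le_of_finrank_eq
    · rw [Submodule.map_span, Submodule.span_le]
      rintro _ ⟨y, rfl | rfl, rfl⟩
      · change p.submodule ≤ W at hpℓ
        rw [hp, Submodule.span_singleton_le_iff_mem] at hpℓ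
        exact hpℓ
      · exact (submodule_bdry_le c hr x).1 hx
    · rw [finrank_span_pair hv, hW]
  rw [lineThru, h]

/-- A vector av + bX of the plane, with X = `cone x`, is lightlike when a(a + 2b⟨v,X⟩) = 0. One root
gives x, the other its reflection, and the last coordinate 1 fixes the scale. -/
theorem bdry_mem_lineThru {x y : S3} :
    bdry c r y ∈ lineThru c hr v x ↔ y = x ∨ y = reflS hv x := by
  rw [bdry_mem_lineThru_iff_mem]
  have hκ := reflPt_denom_pos hv (norm_S3 x)
  constructor
  · intro h
    obtain ⟨a, b, hab⟩ := Submodule.mem_span_pair.1 h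
    have h1 : lor (cone y) (cone y) = 0 := lor_cone_self (norm_S3 y)
    rw [← hab] at h1
    simp only [lor_add_left, lor_add_right, lor_smul_left, lor_smul_right, hv,
      lor_cone_self (norm_S3 x), lor_comm (cone x) v] at h1
    have h2 : a * (a + 2 * b * lor v (cone x)) = 0 := by linarith
    have h3 : a * v.2 + b = 1 := by simpa [cone] using congrArg Prod.snd hab
    have h4 : a • v.1 + b • (x : Euc 4) = y := congrArg Prod.fst hab
    rcases mul_eq_zero.1 h2 with ha | ha
    · left
      rw [ha] at h3 h4
      have : b = 1 := by linarith
      rw [this, zero_smul, zero_add, one_smul] at h4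
      exact Subtype.ext h4.symm
    · right
      apply Subtype.ext
      have ha' : a = -(2 * b * lor v (cone x)) := by linarith
      have hb : b = (1 - 2 * lor v (cone x) * v.2)⁻¹ := by
        apply eq_inv_of_mul_eq_one_left
        rw [ha'] at h3
        linarith
      rw [← h4, ha']
      simp only [reflS, reflPt]
      rw [← hb]
      module
  · rintro (rfl | rfl)
    · exact Submodule.subset_span (by simp)
    · change cone (reflPt v x) ∈ _
      rw [cone_reflPt hv (norm_S3 x)]
      exact Submodule.smul_mem _ _ (Submodule.sub_mem _ (Submodule.subset_span (by simp))
        (Submodule.smul_mem _ _ (Submodule.subset_span (by simp))))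

theorem lineThru_inter_range (x : S3) :
    lineThru c hr v x ∩ Set.range (bdry c r) = {bdry c r x, bdry c r (reflS hv x)} := by
  ext q
  constructor
  · rintro ⟨hq, y, rfl⟩
    rcases (bdry_mem_lineThru hv).1 hq with rfl | rfl <;> simp
  · rintro (rfl | rfl)
    · exact ⟨(bdry_mem_lineThru hv).2 (Or.inl rfl), _, rfl⟩
    · exact ⟨(bdry_mem_lineThru hv).2 (Or.inr rfl), _, rfl⟩

include hv in
theorem ncard_lineThru_inter_range {x : S3} :
    (lineThru c hr v x ∩ Set.range (bdry c r)).ncard = 2 ↔ lor v (cone x) ≠ 0 := by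
  rw [lineThru_inter_range hv, ne_eq, ← reflS_eq_self_iff hv]
  constructor
  · intro h h'
    simp [h'] at h
  · intro h
    exact Set.ncard_pair ((bdry_injective c hr).ne (Ne.symm h))

include hv in
-- A line through p is tangent exactly when its two intersection points, exchanged by the
-- reflection, coincide.
theorem IsPoint.tangencySet_eq {p : RP4} (hp : IsPoint c hr v p) :
    tangencySet c r p = {x : S3 | lor v (cone x) = 0} := by
  ext x
  constructor
  · rintro ⟨ℓ, hℓ, hpℓ, h⟩
    have hx : bdry c r x ∈ ℓ := (h.symm ▸ Set.mem_singleton _ : _ ∈ ℓ ∩ _).1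
    rw [hℓ.eq_lineThru hv hp hpℓ hx, lineThru_inter_range hv] at h
    have h1 : bdry c r (reflS hv x) = bdry c r x := by
      have : bdry c r (reflS hv x) ∈ ({bdry c r x} : Set RP4) := by rw [← h]; simp
      exact this
    exact (reflS_eq_self_iff hv).1 (bdry_injective c hr h1)
  · intro h
    refine ⟨_, isLine_lineThru hv x, hp.mem_lineThru x, ?_⟩
    rw [lineThru_inter_range hv, (reflS_eq_self_iff hv).2 h]
    simp

theorem exists_dsPt {v : Euc 4 × ℝ} (hv : lor v v = 1) :
    ∃ u : Euc 4, ‖u‖ = 1 ∧ v = dsPt v.2 u := by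
  have h := hyp_pos v.2
  refine ⟨(hyp v.2)⁻¹ • v.1, ?_, ?_⟩
  · simp only [lor, real_inner_self_eq_norm_sq] at hv
    have h1 := hyp_sq v.2
    have : ‖v.1‖ = hyp v.2 := by
      rw [← sq_eq_sq₀ (norm_nonneg _) h.le]
      linarith
    rw [norm_smul, norm_inv, Real.norm_of_nonneg h.le, this, inv_mul_cancel₀ h.ne']
  · rw [dsPt, smul_inv_smul₀ h.ne']

theorem continuous_lor_cone (v : Euc 4 × ℝ) : Continuous fun x : S3 => lor v (cone x) := by
  have := contDiff_lor.continuous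
  have := contDiff_cone.continuous
  fun_prop

/-- The cap is the continuous image of ℝ³ under `capPt`. -/
theorem isPreconnected_cap {v : Euc 4 × ℝ} (hv : lor v v = 1) :
    IsPreconnected {x : S3 | 0 < lor v (cone x)} := by
  obtain ⟨u, hu, hvu⟩ := exists_dsPt hv
  generalize v.2 = t at hvu
  subst hvu
  have hc : Continuous fun w : Euc 3 => (⟨capPt t u w, by simpa using norm_capPt t hu w⟩ : S3) := by
    refine Continuous.subtype_mk ?_ _
    have := contDiff_capPt.continuous
    fun_prop
  convert isPreconnected_range hc using 1
  ext x
  constructor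
  · intro hx
    exact ⟨_, Subtype.ext (capPt_coframe hu (norm_S3 x) hx)⟩
  · rintro ⟨w, rfl⟩
    change 0 < lor _ (cone (capPt t u w))
    rw [lor_capPt t hu]
    exact capHeight_pos t w

include hv in
-- A connected set that avoids the zeros of `lor v` carries a single sign, by the intermediate value
-- theorem. Conversely each sign region is connected, the negative one being the positive cap of −v.
theorem IsPoint.sameSide_iff {p : RP4} (hp : IsPoint c hr v p) {a b : S3} :
    SameSide c r p a b ↔ 0 < lor v (cone a) * lor v (cone b) := by
  rw [SameSide, hp.tangencySet_eq hv]
  constructor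
  · intro h
    by_contra! hneg
    have ha : a ∈ {x : S3 | lor v (cone x) = 0}ᶜ := by
      by_contra ha
      rw [connectedComponentIn_eq_empty ha] at h
      exact h
    have hs := isPreconnected_connectedComponentIn (x := a) (F := {x : S3 | lor v (cone x) = 0}ᶜ)
    have hsub := connectedComponentIn_subset {x : S3 | lor v (cone x) = 0}ᶜ a
    have haa := mem_connectedComponentIn ha
    have h0 : (0 : ℝ) ∈ (fun x : S3 => lor v (cone x)) ''
        connectedComponentIn {x : S3 | lor v (cone x) = 0}ᶜ a := by
      have hconn := (hs.image _ (continuous_lor_cone v).continuousOn).ordConnected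
      rcases mul_nonpos_iff.1 hneg with h1 | h1
      · exact hconn.out ⟨b, h, rfl⟩ ⟨a, haa, rfl⟩ ⟨h1.2, h1.1⟩
      · exact hconn.out ⟨a, haa, rfl⟩ ⟨b, h, rfl⟩ ⟨h1.1, h1.2⟩
    obtain ⟨x, hx, hx0⟩ := h0
    exact hsub hx hx0
  · intro h
    rcases pos_and_pos_or_neg_and_neg_of_mul_pos h with ⟨ha, hb⟩ | ⟨ha, hb⟩
    · exact (isPreconnected_cap hv).subset_connectedComponentIn ha
        (fun x hx => (ne_of_gt hx : lor v (cone x) ≠ 0)) hb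
    · have hneg (x : S3) : lor (-v) (cone x) = -lor v (cone x) := by
        rw [← neg_one_smul ℝ v, lor_smul_left]; ring
      have hv' : lor (-v) (-v) = 1 := by
        rw [← neg_one_smul ℝ v, lor_smul_left, lor_smul_right, hv]; ring
      refine (isPreconnected_cap hv').subset_connectedComponentIn (x := a) ?_ (fun x hx => ?_) ?_
      · simpa [hneg] using ha
      · have : lor v (cone x) < 0 := by simpa [hneg] using hx
        exact this.ne
      · simpa [hneg] using hb

end Lines

/-! ### The graph and the labelling by the 6-cycle -/

/-- The family of lines through a point and three points of the sphere. -/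
def lineFamily (c : Euc 4) {r : ℝ} (hr : r ≠ 0) (v : Euc 4 × ℝ) (z : Fin 3 → S3) : Set (Set RP4) :=
  Set.range fun i => lineThru c hr v (z i)

/-- Parity records the side and the residue mod 3 records the line. By the Chinese remainder
theorem, residues mod 6 that differ in both respects differ by ±1. -/
theorem not_sameSide_or_sameLine_iff :
    ∀ i j : Fin 6, (i ≠ j ∧ ¬(i.val % 2 = j.val % 2 ∨ i.val % 3 = j.val % 3)) ↔
      (SimpleGraph.cycleGraph 6).Adj i j := by
  decide

theorem IsPoint.lineGraph_adj_iff {c : Euc 4} {r : ℝ} {hr : r ≠ 0} {v : Euc 4 × ℝ} {p : RP4}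
    (hp : IsPoint c hr v p) (hv : lor v v = 1) {L : Set (Set RP4)} {a b : IntersectionPt c r L} :
    (lineGraph c r p L).Adj a b ↔ a ≠ b ∧ (0 < lor v (cone a.1) * lor v (cone b.1) ∨
      ∃ ℓ ∈ L, bdry c r a.1 ∈ ℓ ∧ bdry c r b.1 ∈ ℓ) := by
  unfold lineGraph
  rw [SimpleGraph.fromRel_adj, hp.sameSide_iff hv, hp.sameSide_iff hv,
    mul_comm (lor v (cone b.1))]
  simp only [and_comm (a := bdry c r b.1 ∈ _), or_self]

namespace Moduli

variable {c : Euc 4} {r : ℝ}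

theorem cycleGraph_adj_iff (m : Moduli c r) (i j : Fin 6) :
    (SimpleGraph.cycleGraph 6).Adj i j ↔
      i ≠ j ∧ ¬(lineGraph c r m.p m.lines).Adj (m.iso.symm i) (m.iso.symm j) := by
  rw [← m.iso.symm.map_rel_iff', SimpleGraph.compl_adj]
  exact and_congr_left' m.iso.symm.injective.ne_iff

theorem exists_line_mem (m : Moduli c r) (i : Fin 6) :
    ∃ ℓ ∈ m.lines, bdry c r (m.label.1 i) ∈ ℓ := (m.iso.symm i).2

theorem exists_label_eq (m : Moduli c r) {x : S3} (hx : ∃ ℓ ∈ m.lines, bdry c r x ∈ ℓ) :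
    ∃ i, m.label.1 i = x :=
  ⟨m.iso ⟨x, hx⟩, congrArg Subtype.val (m.iso.symm_apply_apply ⟨x, hx⟩)⟩

section

variable (m : Moduli c r) {hr : r ≠ 0} {v : Euc 4 × ℝ} (hv : lor v v = 1)
  (hp : IsPoint c hr v m.p)

include hv hp

theorem eq_lineThru {ℓ : Set RP4} (hℓ : ℓ ∈ m.lines) {x : S3} (hx : bdry c r x ∈ ℓ) :
    ℓ = lineThru c hr v x :=
  (m.isLine ℓ hℓ).eq_lineThru hv hp (m.p_mem ℓ hℓ) hx

theorem lor_label_ne_zero (i : Fin 6) : lor v (cone (m.label.1 i)) ≠ 0 := by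
  obtain ⟨ℓ, hℓ, hx⟩ := m.exists_line_mem i
  rw [← ncard_lineThru_inter_range (c := c) (hr := hr) hv, ← m.eq_lineThru hv hp hℓ hx]
  exact m.meets_twice ℓ hℓ

theorem lineGraph_adj_iff {i j : Fin 6} (hij : i ≠ j) :
    (lineGraph c r m.p m.lines).Adj (m.iso.symm i) (m.iso.symm j) ↔
      0 < lor v (cone (m.label.1 i)) * lor v (cone (m.label.1 j)) ∨
        m.label.1 j = reflS hv (m.label.1 i) := by
  have hne : m.iso.symm i ≠ m.iso.symm j := m.iso.symm.injective.ne hij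
  have hne' : m.label.1 j ≠ m.label.1 i := m.label.2.ne hij.symm
  have hline : (∃ ℓ ∈ m.lines, bdry c r (m.label.1 i) ∈ ℓ ∧ bdry c r (m.label.1 j) ∈ ℓ) ↔
      m.label.1 j = reflS hv (m.label.1 i) := by
    constructor
    · rintro ⟨ℓ, hℓ, hi, hj⟩
      rw [m.eq_lineThru hv hp hℓ hi, bdry_mem_lineThru hv] at hj
      exact hj.resolve_left hne'
    · intro h
      obtain ⟨ℓ, hℓ, hi⟩ := m.exists_line_mem i
      refine ⟨ℓ, hℓ, hi, ?_⟩
      rw [m.eq_lineThru hv hp hℓ hi, bdry_mem_lineThru hv]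
      exact Or.inr h
  rw [hp.lineGraph_adj_iff hv, ← hline]
  exact and_iff_right hne

/-- Neighbours in the cycle are not joined in G, hence not on the same side, and no intersection
point lies on T_p because every line meets the sphere twice. -/
theorem lor_mul_lor_neg {i j : Fin 6} (h : (SimpleGraph.cycleGraph 6).Adj i j) :
    lor v (cone (m.label.1 i)) * lor v (cone (m.label.1 j)) < 0 := by
  have hij := h.ne
  rw [m.cycleGraph_adj_iff, m.lineGraph_adj_iff hv hp hij, not_or, not_lt] at h
  exact lt_of_le_of_ne h.2.1
    (mul_ne_zero (m.lor_label_ne_zero hv hp i) (m.lor_label_ne_zero hv hp j))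

theorem label_eq_reflS {i j : Fin 6} (hij : i ≠ j) (h : ¬(SimpleGraph.cycleGraph 6).Adj i j)
    (hneg : lor v (cone (m.label.1 i)) * lor v (cone (m.label.1 j)) < 0) :
    m.label.1 j = reflS hv (m.label.1 i) := by
  rw [m.cycleGraph_adj_iff, m.lineGraph_adj_iff hv hp hij] at h
  push Not at h
  exact (h hij).resolve_left hneg.not_gt

end

theorem exists_isPoint (hr0 : 0 < r) (m : Moduli c r) :
    ∃ v, lor v v = 1 ∧ IsPoint c hr0.ne' v m.p ∧ 0 < lor v (cone (m.label.1 0)) := by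
  obtain ⟨v, hv, hp⟩ := exists_lor_eq_one_of_notMem_ball4 (hr := hr0.ne') hr0 m.p_notMem
  rcases (m.lor_label_ne_zero hv hp 0).lt_or_gt with h | h
  · refine ⟨(-1 : ℝ) • v, ?_, hp.smul (by norm_num), ?_⟩
    · rw [lor_smul_left, lor_smul_right, hv]
      ring
    · rw [lor_smul_left]
      linarith
  · exact ⟨v, hv, hp, h⟩

theorem exists_label_eq_paramConf (hr0 : 0 < r) (m : Moduli c r) :
    ∃ n : ParamManifold, m.label = paramConf n ∧
      IsPoint c hr0.ne' (dsPt (paramIncl n).1 (paramIncl n).2.1) m.p := by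
  obtain ⟨v, hv, hp, h0⟩ := m.exists_isPoint hr0
  have hneg (i j : Fin 6) (h : (SimpleGraph.cycleGraph 6).Adj i j) := m.lor_mul_lor_neg hv hp h
  -- The signs alternate around the cycle, starting with a positive one.
  have h1 := neg_of_mul_neg_right (hneg 0 1 (by decide)) h0.le
  have h2 := pos_of_mul_neg_right (hneg 1 2 (by decide)) h1.le
  have h3 := neg_of_mul_neg_right (hneg 2 3 (by decide)) h2.le
  have h4 := pos_of_mul_neg_right (hneg 3 4 (by decide)) h3.le
  have h5 := neg_of_mul_neg_right (hneg 4 5 (by decide)) h4.le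
  -- Opposite vertices are not neighbours in the cycle, so they are joined in G. Being on different
  -- sides, they must share a line.
  have h03 := m.label_eq_reflS hv hp (i := 0) (j := 3) (by decide) (by decide)
    (mul_neg_of_pos_of_neg h0 h3)
  have h25 := m.label_eq_reflS hv hp (i := 2) (j := 5) (by decide) (by decide)
    (mul_neg_of_pos_of_neg h2 h5)
  have h41 := m.label_eq_reflS hv hp (i := 4) (j := 1) (by decide) (by decide)
    (mul_neg_of_pos_of_neg h4 h1)
  obtain ⟨u, hu, hvu⟩ := exists_dsPt hv
  generalize v.2 = t at hvu
  subst hvu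
  let a : Fin 3 → Fin 6 := ![0, 2, 4]
  let w : Fin 3 → Euc 3 := fun i =>
    (lor (dsPt t u) (cone (m.label.1 (a i))))⁻¹ • coframe u (m.label.1 (a i))
  have hw (i : Fin 3) : capPt t u (w i) = m.label.1 (a i) := by
    refine capPt_coframe hu (norm_S3 _) ?_
    fin_cases i
    exacts [h0, h2, h4]
  have hq : IsParam (t, u, w) := by
    refine ⟨hu, fun i j hij => ?_⟩
    have ha : Function.Injective a := by decide
    refine ha (m.label.2 (Subtype.ext ?_))
    rw [← hw, ← hw]
    exact congrArg _ hij
  obtain ⟨n, hn⟩ := hq.exists_paramIncl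
  refine ⟨n, injective_confVec ?_, by rwa [hn]⟩
  rw [confVec_paramConf, hn]
  funext i
  have hr' (i : Fin 3) : reflPt (dsPt t u) (capPt t u (w i)) = reflS hv (m.label.1 (a i)) := by
    rw [hw]
    rfl
  fin_cases i
  · exact (hw 0).symm
  · exact (congrArg Subtype.val h41).trans (hr' 2).symm
  · exact (hw 1).symm
  · exact (congrArg Subtype.val h03).trans (hr' 0).symm
  · exact (hw 2).symm
  · exact (congrArg Subtype.val h25).trans (hr' 1).symm

theorem lines_subset {m m' : Moduli c r} {hr : r ≠ 0} {v : Euc 4 × ℝ} (hv : lor v v = 1)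
    (hp : IsPoint c hr v m.p) (hp' : IsPoint c hr v m'.p) (h : m.label = m'.label) :
    m.lines ⊆ m'.lines := by
  intro ℓ hℓ
  obtain ⟨_, hx, x, rfl⟩ : (ℓ ∩ Set.range (bdry c r)).Nonempty := by
    apply Set.nonempty_of_ncard_ne_zero
    rw [m.meets_twice ℓ hℓ]
    exact two_ne_zero
  obtain ⟨i, rfl⟩ := m.exists_label_eq ⟨ℓ, hℓ, hx⟩
  obtain ⟨ℓ', hℓ', hx'⟩ := m'.exists_line_mem i
  rw [← h] at hx'
  rwa [m.eq_lineThru hv hp hℓ hx, ← m'.eq_lineThru hv hp' hℓ' hx']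

/-- The labels determine the parameters, hence v and p. Each line is then the one through p and a
labelled point, and the isomorphism is the labelling itself. -/
theorem label_injective (hr0 : 0 < r) : Function.Injective (label (c := c) (r := r)) := by
  intro m m' h
  obtain ⟨n, hn, hp⟩ := m.exists_label_eq_paramConf hr0
  obtain ⟨n', hn', hp'⟩ := m'.exists_label_eq_paramConf hr0
  obtain rfl : n = n' := paramConf_injective (by rw [← hn, ← hn', h])
  have hv := (isParam_paramIncl n).lor_self
  have hpp := hp.unique hp'
  have hll := (lines_subset hv hp hp' h).antisymm (lines_subset hv hp' hp h.symm)
  obtain ⟨p, _, L, _, _, _, _, f⟩ := m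
  obtain ⟨p', _, L', _, _, _, _, f'⟩ := m'
  dsimp only at hpp hll
  subst hpp hll
  congr 1
  have hs : ∀ i, f.symm i = f'.symm i := fun i =>
    Subtype.ext (congrFun (congrArg Subtype.val h) i)
  ext x
  obtain ⟨i, rfl⟩ := f.symm.surjective x
  rw [f.apply_symm_apply, hs, f'.apply_symm_apply]

end Moduli

/-! ### Realising every parameter by a configuration of lines -/

section Surjective

variable {c : Euc 4} {r : ℝ} {hr : r ≠ 0} {v : Euc 4 × ℝ} (hv : lor v v = 1) {z : Fin 3 → S3}
  (hz : ∀ i, 0 < lor v (cone (z i))) (hinj : Function.Injective z)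

/-- The six intersection points with the sphere, in cyclic order. -/
noncomputable def hexagonS (z : Fin 3 → S3) : Fin 6 → S3 :=
  ![z 0, reflS hv (z 2), z 1, reflS hv (z 0), z 2, reflS hv (z 1)]

theorem coe_hexagonS (i : Fin 6) : (hexagonS hv z i : Euc 4) = hexagon v (fun i => z i) i := by
  fin_cases i <;> rfl

include hz in
theorem reflS_ne (i j : Fin 3) : z j ≠ reflS hv (z i) := fun h =>
  reflPt_ne_of_pos hv (norm_S3 (z i)) (hz i) (hz j) (congrArg Subtype.val h)

include hz hinj in
theorem hexagonS_injective : Function.Injective (hexagonS hv z) := by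
  intro i j h
  refine hexagon_injective hv (fun i => norm_S3 (z i)) hz
    (Subtype.val_injective.comp hinj) ?_
  rw [← coe_hexagonS hv, h, coe_hexagonS]

include hz in
theorem lor_hexagonS_pos_iff (i : Fin 6) :
    lor v (cone (hexagonS hv z i)) ≠ 0 ∧
      (0 < lor v (cone (hexagonS hv z i)) ↔ i.val % 2 = 0) := by
  have h (i : Fin 3) : lor v (cone (reflS hv (z i))) < 0 := by
    have h1 := mul_pos (inv_pos.2 (reflPt_denom_pos hv (norm_S3 (z i)))) (hz i)
    have h2 := lor_reflPt hv (norm_S3 (z i))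
    change lor v (cone (reflPt v (z i))) < 0
    linarith
  have hpos (i : Fin 3) : lor v (cone (z i)) ≠ 0 ∧ (0 < lor v (cone (z i)) ↔ True) :=
    ⟨(hz i).ne', iff_true_intro (hz i)⟩
  have hneg (i : Fin 3) : lor v (cone (reflS hv (z i))) ≠ 0 ∧
      (0 < lor v (cone (reflS hv (z i))) ↔ False) :=
    ⟨(h i).ne, iff_false_intro (h i).not_gt⟩
  fin_cases i
  exacts [⟨(hpos 0).1, (hpos 0).2.trans (by decide)⟩, ⟨(hneg 2).1, (hneg 2).2.trans (by decide)⟩,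
    ⟨(hpos 1).1, (hpos 1).2.trans (by decide)⟩, ⟨(hneg 0).1, (hneg 0).2.trans (by decide)⟩,
    ⟨(hpos 2).1, (hpos 2).2.trans (by decide)⟩, ⟨(hneg 1).1, (hneg 1).2.trans (by decide)⟩]

include hz hinj in
-- The line through `z k` carries the opposite vertices 2k and 2k + 3 mod 6, which are the two
-- residues mod 6 congruent to 2k mod 3.
theorem bdry_hexagonS_mem (k : Fin 3) (i : Fin 6) :
    bdry c r (hexagonS hv z i) ∈ lineThru c hr v (z k) ↔ i.val % 3 = (2 * k.val) % 3 := by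
  have h1 : ∀ k : Fin 3, z k = hexagonS hv z (![0, 2, 4] k) ∧
      reflS hv (z k) = hexagonS hv z (![3, 5, 1] k) := by
    intro k
    fin_cases k <;> exact ⟨rfl, rfl⟩
  rw [bdry_mem_lineThru hv, (h1 k).1, ← (h1 k).1, (h1 k).2, (h1 k).1,
    (hexagonS_injective hv hz hinj).eq_iff, (hexagonS_injective hv hz hinj).eq_iff]
  revert i k
  decide

include hv hz hinj in
theorem ncard_lineFamily : (lineFamily c hr v z).ncard = 3 := by
  have h : Function.Injective fun i => lineThru c hr v (z i) := by
    intro i j hij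
    have h1 : bdry c r (z j) ∈ lineThru c hr v (z i) := by
      rw [show lineThru c hr v (z i) = _ from hij]
      exact bdry_mem_lineThru_self _
    exact (hinj (((bdry_mem_lineThru hv).1 h1).resolve_right (reflS_ne hv hz i j))).symm
  rw [lineFamily, ← Set.image_univ, Set.ncard_image_of_injective _ h, Set.ncard_univ,
    Nat.card_eq_fintype_card, Fintype.card_fin]

include hz in
theorem lor_hexagonS_mul_pos_iff (i j : Fin 6) :
    0 < lor v (cone (hexagonS hv z i)) * lor v (cone (hexagonS hv z j)) ↔
      i.val % 2 = j.val % 2 := by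
  obtain ⟨hi, hi'⟩ := lor_hexagonS_pos_iff hv hz i
  obtain ⟨hj, hj'⟩ := lor_hexagonS_pos_iff hv hz j
  rcases hi.lt_or_gt with h1 | h1 <;> rcases hj.lt_or_gt with h2 | h2
  · have h3 := hi'.not.1 h1.not_gt
    have h4 := hj'.not.1 h2.not_gt
    exact iff_of_true (mul_pos_of_neg_of_neg h1 h2) (by omega)
  · have h3 := hi'.not.1 h1.not_gt
    have h4 := hj'.1 h2
    exact iff_of_false (mul_neg_of_neg_of_pos h1 h2).not_gt (by omega)
  · have h3 := hi'.1 h1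
    have h4 := hj'.not.1 h2.not_gt
    exact iff_of_false (mul_neg_of_pos_of_neg h1 h2).not_gt (by omega)
  · have h3 := hi'.1 h1
    have h4 := hj'.1 h2
    exact iff_of_true (mul_pos h1 h2) (by omega)

/-- The `i`-th vertex of the hexagon, as an intersection point. -/
noncomputable def hexagonPt (hr : r ≠ 0) (i : Fin 6) :
    IntersectionPt c r (lineFamily c hr v z) :=
  ⟨hexagonS hv z i, by
    obtain ⟨k, hk⟩ : ∃ k : Fin 3, i.val % 3 = (2 * k.val) % 3 := by
      revert i
      decide
    exact ⟨_, ⟨k, rfl⟩, (bdry_hexagonS_mem hv hz hinj k i).2 hk⟩⟩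

theorem hexagonPt_bijective :
    Function.Bijective (hexagonPt (c := c) hv hz hinj hr) := by
  constructor
  · exact fun i j h => hexagonS_injective hv hz hinj (congrArg Subtype.val h)
  · rintro ⟨y, _, ⟨k, rfl⟩, hy⟩
    rcases (bdry_mem_lineThru hv).1 hy with rfl | rfl
    · refine ⟨![0, 2, 4] k, Subtype.ext ?_⟩
      fin_cases k <;> rfl
    · refine ⟨![3, 5, 1] k, Subtype.ext ?_⟩
      fin_cases k <;> rfl

/-- Same side means equal parity and same line means equal residue mod 3, so the claim reduces to
the arithmetic of `not_sameSide_or_sameLine_iff`. -/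
theorem compl_lineGraph_adj_hexagonPt {p : RP4} (hp : IsPoint c hr v p) (i j : Fin 6) :
    (lineGraph c r p (lineFamily c hr v z))ᶜ.Adj (hexagonPt hv hz hinj hr i)
      (hexagonPt hv hz hinj hr j) ↔ (SimpleGraph.cycleGraph 6).Adj i j := by
  have hline : (∃ ℓ ∈ lineFamily c hr v z, bdry c r (hexagonS hv z i) ∈ ℓ ∧
      bdry c r (hexagonS hv z j) ∈ ℓ) ↔ i.val % 3 = j.val % 3 := by
    rw [lineFamily, Set.exists_range_iff]
    simp only [bdry_hexagonS_mem hv hz hinj]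
    revert i j
    decide
  rw [SimpleGraph.compl_adj, hp.lineGraph_adj_iff hv, (hexagonPt_bijective hv hz hinj).1.ne_iff,
    ← not_sameSide_or_sameLine_iff, ← hline, ← lor_hexagonS_mul_pos_iff hv hz]
  exact and_congr_right fun h => not_congr (and_iff_right h)

include hz hinj in
theorem exists_moduli_label_eq_hexagonS (hr0 : 0 < r) :
    ∃ m : Moduli c r, m.label.1 = hexagonS hv z := by
  have hr := hr0.ne'
  obtain ⟨p, hp⟩ := exists_isPoint c hr (ne_zero_of_lor hv)
  let e := Equiv.ofBijective _ (hexagonPt_bijective (c := c) (hr := hr) hv hz hinj)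
  let f : SimpleGraph.cycleGraph 6 ≃g (lineGraph c r p (lineFamily c hr v z))ᶜ :=
    ⟨e, compl_lineGraph_adj_hexagonPt hv hz hinj hp _ _⟩
  refine ⟨⟨p, hp.notMem_ball4 hv hr0, _, ncard_lineFamily hv hz hinj, ?_, ?_, ?_, f.symm⟩, rfl⟩
  · rintro _ ⟨i, rfl⟩
    exact isLine_lineThru hv _
  · rintro _ ⟨i, rfl⟩
    exact hp.mem_lineThru _
  · rintro _ ⟨i, rfl⟩
    exact (ncard_lineThru_inter_range hv).2 (hz i).ne'

end Surjective

/-! ### Conclusion -/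

theorem exists_moduli_label_eq {c : Euc 4} {r : ℝ} (hr0 : 0 < r) (n : ParamManifold) :
    ∃ m : Moduli c r, m.label = paramConf n := by
  have hn := isParam_paramIncl n
  obtain ⟨m, hm⟩ := exists_moduli_label_eq_hexagonS (c := c) hn.lor_self
    (z := fun i => ⟨_, mem_sphere_zero_iff_norm.2 (hn.norm_cap i)⟩) hn.lor_cap_pos
    (fun i j h => hn.cap_injective (congrArg Subtype.val h)) hr0
  refine ⟨m, injective_confVec (funext fun i => ?_)⟩
  rw [confVec, hm, coe_hexagonS]
  rfl

theorem mainTheorem10 (c : Euc 4) (r : ℝ) (hr : 0 < r) :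
    ∃ (_ : ChartedSpace (Euc 13) (Moduli c r)) (_ : IsManifold (𝓡 13) ∞ (Moduli c r)),
      -- `M` is an embedded 13-dimensional smooth submanifold of `C₆(S³)`
      (Topology.IsEmbedding (Moduli.label (c := c) (r := r)) ∧
        ContMDiff (𝓡 13) modelConf6 ∞ (Moduli.label (c := c) (r := r)) ∧
        ∀ m : Moduli c r,
          Function.Injective (mfderiv (𝓡 13) modelConf6 (Moduli.label (c := c) (r := r)) m)) ∧
      -- `M` is diffeomorphic to `ℝ × S³ × C₃(ℝ³)`
      Nonempty (Moduli c r ≃ₘ^∞⟮𝓡 13, 𝓘(ℝ, ℝ).prod ((𝓡 3).prod modelConf3)⟯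
        (ℝ × S3 × Conf 3 (Euc 3))) := by
  choose f hf using fun m : Moduli c r => m.exists_label_eq_paramConf hr
  have hbij : Function.Bijective f := by
    constructor
    · intro m m' h
      apply Moduli.label_injective hr
      rw [(hf m).1, (hf m').1, h]
    · intro n
      obtain ⟨m, hm⟩ := exists_moduli_label_eq (c := c) hr n
      exact ⟨m, paramConf_injective (by rw [← (hf m).1, hm])⟩
  exact exists_manifold_of_equiv (Equiv.ofBijective f hbij) fun m => (hf m).1
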